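/- Let $\mathbb N=\{1,2,3,\dots\}$, let $$s=\{x\in\mathbb C^{\mathbb N}:\ \sup_i i^r|x_i|<\infty\ \text{ for all } r\in\mathbb N_0\}$$ be the space of rapidly decreasing sequences, topologized by the seminorms $x\mapsto\sup_i i^r|x_i|$, $r\in\mathbb N_0$. For $1\le p\le\infty$ and $k\in\mathbb Z$ let $(\ell^p)_{-k}=\{x\in\mathbb C^{\mathbb N}: (j^{-k}x_j)_j\in\ell^p\}$ with norm $\|(j^{-k}x_j)_j\|_{\ell^p}$, and let $(c_0)_{-k}=\{x\in\mathbb C^{\mathbb N}: j^{-k}x_j\to0\}$ with norm $\sup_j j^{-k}|x_j|$. Let $s\,\widehat\otimes\, F$ denote the completed projective tensor product, i.e. the completion of $s\otimes F$ for the finest locally convex topology that makes the canonical bilinear map $s\times F\to s\otimes F$ continuous. **Proposition.** Let $1\le p\le\infty$, and let $E_k=s\,\widehat\otimes\,(\ell^p)_{-k}$ for all $k\in\mathbb Z$, or $E_k=s\,\widehat\otimes\,(c_0)_{-k}$ for all $k\in\mathbb Z$. For $k\le l$ let $E_k\to E_l$ be the continuous linear extension of $\mathrm{id}\otimes\iota$,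 where $\iota$ is the inclusion $(\ell^p)_{-k}\subseteq(\ell^p)_{-l}$, respectively $(c_0)_{-k}\subseteq(c_0)_{-l}$. Let $E=\operatorname{ind\,lim}_k E_k$ be the inductive limit of the $E_k$ along these maps, with the finest locally convex topology for which all canonical maps $E_k\to E$ are continuous. Then: 1. $E$ is an LF-space: every $E_k$ is a Fréchet space, the maps $E_k\to E_l$ are injective and compatible with composition, and $E$ is Hausdorff. 2. $E$ is compactly regular: every compact subset of $E$ is contained in some step $E_k$ and is compact in $E_k$. 3. $E$ is complete. -/

import Mathlib

open scoped TensorProduct ENNReal Topology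

noncomputable section

/-! ### Finest locally convex topologies -/

/-- `t` is a locally convex vector space topology on the complex vector space `V`. -/
def IsLocallyConvexTopology (V : Type*) [AddCommGroup V] [Module ℂ V]
    (t : TopologicalSpace V) : Prop :=
  @IsTopologicalAddGroup V t _ ∧ @ContinuousSMul ℂ V _ _ t ∧ @LocallyConvexSpace ℝ V _ _ _ _ t

/-- The supremum of all locally convex topologies on `V` that satisfy `P` (in Mathlib's order on
topologies this is an `sInf`). If `P` says that certain maps into `V` are continuous, then this
topology itself satisfies `P`, and so it is the finest locally convex topology satisfying `P`. -/
@[reducible]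
def finestLocallyConvex (V : Type*) [AddCommGroup V] [Module ℂ V]
    (P : TopologicalSpace V → Prop) : TopologicalSpace V :=
  sInf {t | IsLocallyConvexTopology V t ∧ P t}

theorem isLocallyConvexTopology_finest (V : Type*) [AddCommGroup V] [Module ℂ V]
    (P : TopologicalSpace V → Prop) :
    IsLocallyConvexTopology V (finestLocallyConvex V P) :=
  ⟨topologicalAddGroup_sInf fun _ ht => ht.1.1, continuousSMul_sInf fun _ ht => ht.1.2.1,
    LocallyConvexSpace.sInf fun _ ht => ht.1.2.2⟩

/-- The uniform structure of the additive topological group `(V, finestLocallyConvex V P)`. -/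
@[reducible]
def finestLocallyConvexUniform (V : Type*) [AddCommGroup V] [Module ℂ V]
    (P : TopologicalSpace V → Prop) : UniformSpace V :=
  @IsTopologicalAddGroup.rightUniformSpace V _ (finestLocallyConvex V P)
    (isLocallyConvexTopology_finest V P).1

theorem isUniformAddGroup_finest (V : Type*) [AddCommGroup V] [Module ℂ V]
    (P : TopologicalSpace V → Prop) :
    @IsUniformAddGroup V (finestLocallyConvexUniform V P) _ :=
  @isUniformAddGroup_of_addCommGroup V _ (finestLocallyConvex V P)
    (isLocallyConvexTopology_finest V P).1

/-! ### The completed projective tensor product -/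

section ProjectiveTensor

variable (E F G : Type*)
  [AddCommGroup E] [Module ℂ E] [TopologicalSpace E]
  [AddCommGroup F] [Module ℂ F] [TopologicalSpace F]
  [AddCommGroup G] [Module ℂ G] [TopologicalSpace G]

/-- The algebraic tensor product `E ⊗ F`, to be equipped with the `π`-topology. -/
def ProjTensor : Type _ := E ⊗[ℂ] F

instance : AddCommGroup (ProjTensor E F) := inferInstanceAs (AddCommGroup (E ⊗[ℂ] F))

instance : Module ℂ (ProjTensor E F) := inferInstanceAs (Module ℂ (E ⊗[ℂ] F))

/-- The canonical bilinear map `E × F → E ⊗ F`. -/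
def ProjTensor.mk : E →ₗ[ℂ] F →ₗ[ℂ] ProjTensor E F := TensorProduct.mk ℂ E F

/-- The projective topology: the finest locally convex topology on `E ⊗ F` for which the canonical
bilinear map `E × F → E ⊗ F` is (jointly) continuous. -/
instance : UniformSpace (ProjTensor E F) :=
  finestLocallyConvexUniform (ProjTensor E F) fun t =>
    @Continuous (E × F) (ProjTensor E F) _ t fun x => ProjTensor.mk E F x.1 x.2

instance : IsUniformAddGroup (ProjTensor E F) := isUniformAddGroup_finest _ _

instance : ContinuousSMul ℂ (ProjTensor E F) := (isLocallyConvexTopology_finest _ _).2.1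

instance : UniformContinuousConstSMul ℂ (ProjTensor E F) :=
  uniformContinuousConstSMul_of_continuousConstSMul ℂ (ProjTensor E F)

instance : LocallyConvexSpace ℝ (ProjTensor E F) := (isLocallyConvexTopology_finest _ _).2.2

theorem ProjTensor.continuous_mk :
    Continuous fun x : E × F => ProjTensor.mk E F x.1 x.2 :=
  continuous_sInf_rng.2 fun _ ht => ht.2

/-- The completed projective tensor product of `E` and `F`. -/
abbrev CompletedTensor : Type _ := UniformSpace.Completion (ProjTensor E F)

variable {F G}

/-- The algebraic map `id ⊗ g : E ⊗ F → E ⊗ G`. -/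
def ProjTensor.lTensorLinear (g : F →L[ℂ] G) : ProjTensor E F →ₗ[ℂ] ProjTensor E G :=
  LinearMap.lTensor E g.toLinearMap

/-- `id ⊗ g : E ⊗ F → E ⊗ G` is continuous for the projective topologies. -/
def ProjTensor.lTensor (g : F →L[ℂ] G) : ProjTensor E F →L[ℂ] ProjTensor E G where
  toLinearMap := ProjTensor.lTensorLinear E g
  cont := by
    refine continuous_iff_le_induced.2 (sInf_le ⟨⟨?_, ?_, ?_⟩, ?_⟩)
    · exact topologicalAddGroup_induced (ProjTensor.lTensorLinear E g)
    · exact continuousSMul_induced (ProjTensor.lTensorLinear E g)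
    · exact LocallyConvexSpace.induced ((ProjTensor.lTensorLinear E g).restrictScalars ℝ)
    · refine continuous_induced_rng.2 ?_
      exact (ProjTensor.continuous_mk E G).comp
        (continuous_fst.prodMk (g.continuous.comp continuous_snd))

theorem ProjTensor.completion_map_coe (g : F →L[ℂ] G) (a : ProjTensor E F) :
    UniformSpace.Completion.map (ProjTensor.lTensor E g) (a : CompletedTensor E F) =
      (ProjTensor.lTensor E g a : CompletedTensor E G) :=
  UniformSpace.Completion.map_coe (ProjTensor.lTensor E g).uniformContinuous a

/-- The continuous linear extension of `id ⊗ g` to the completed projective tensor products. -/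
def CompletedTensor.lTensor (g : F →L[ℂ] G) : CompletedTensor E F →L[ℂ] CompletedTensor E G where
  toFun := UniformSpace.Completion.map (ProjTensor.lTensor E g)
  map_add' x y := by
    have hc : Continuous (UniformSpace.Completion.map (ProjTensor.lTensor E g)) :=
      UniformSpace.Completion.continuous_map
    refine UniformSpace.Completion.induction_on₂ x y (isClosed_eq ?_ ?_) fun a b => ?_
    · exact hc.comp continuous_add
    · exact (hc.comp continuous_fst).add
        (hc.comp continuous_snd)
    · rw [← UniformSpace.Completion.coe_add, ProjTensor.completion_map_coe,
        ProjTensor.completion_map_coe, ProjTensor.completion_map_coe, map_add,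
        UniformSpace.Completion.coe_add]
  map_smul' c x := by
    refine UniformSpace.Completion.induction_on x (isClosed_eq ?_ ?_) fun a => ?_
    · exact UniformSpace.Completion.continuous_map.comp (continuous_const_smul c)
    · exact (continuous_const_smul c).comp UniformSpace.Completion.continuous_map
    · rw [← UniformSpace.Completion.coe_smul, ProjTensor.completion_map_coe,
        ProjTensor.completion_map_coe, map_smul, UniformSpace.Completion.coe_smul,
        RingHom.id_apply]
  cont := UniformSpace.Completion.continuous_map

end ProjectiveTensor

/-! ### Locally convex inductive limits -/

section InductiveLimit

variable (E : ℤ → Type*) [∀ k, AddCommGroup (E k)] [∀ k, Module ℂ (E k)]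
  [∀ k, UniformSpace (E k)]
  (f : ∀ k l : ℤ, k ≤ l → E k →L[ℂ] E l)

/-- The algebraic inductive limit of the spectrum `(E k)` with linking maps `f k l`. -/
def IndLim : Type _ := Module.DirectLimit E fun k l h => (f k l h).toLinearMap

instance : AddCommGroup (IndLim E f) :=
  inferInstanceAs (AddCommGroup (Module.DirectLimit E fun k l h => (f k l h).toLinearMap))

instance : Module ℂ (IndLim E f) :=
  inferInstanceAs (Module ℂ (Module.DirectLimit E fun k l h => (f k l h).toLinearMap))

/-- The canonical map from the step `E k` to the inductive limit. -/
def IndLim.of (k : ℤ) : E k →ₗ[ℂ] IndLim E f :=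
  Module.DirectLimit.of ℂ ℤ E (fun k l h => (f k l h).toLinearMap) k

/-- The inductive limit topology: the finest locally convex topology for which the canonical maps
from the steps are continuous. -/
instance : UniformSpace (IndLim E f) :=
  finestLocallyConvexUniform (IndLim E f) fun t =>
    ∀ k, @Continuous (E k) (IndLim E f) _ t (IndLim.of E f k)

instance : IsUniformAddGroup (IndLim E f) := isUniformAddGroup_finest _ _

instance : ContinuousSMul ℂ (IndLim E f) := (isLocallyConvexTopology_finest _ _).2.1

instance : LocallyConvexSpace ℝ (IndLim E f) := (isLocallyConvexTopology_finest _ _).2.2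

/-- A Fréchet space: a complete metrizable locally convex space. -/
structure IsFrechetSpace (V : Type*) [AddCommGroup V] [Module ℂ V] [UniformSpace V] : Prop where
  isUniformAddGroup : IsUniformAddGroup V
  continuousSMul : ContinuousSMul ℂ V
  locallyConvex : LocallyConvexSpace ℝ V
  metrizable : TopologicalSpace.MetrizableSpace V
  complete : CompleteSpace V

/-- `(E k)` is a spectrum of Fréchet spaces with continuous injective linking maps, and its
locally convex inductive limit is Hausdorff: the inductive limit is an LF-space. -/
structure IsLFSpace : Prop where
  frechet : ∀ k, IsFrechetSpace (E k)
  map_self : ∀ k (x : E k), f k k le_rfl x = x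
  map_map : ∀ k l m (hkl : k ≤ l) (hlm : l ≤ m) (x : E k),
    f l m hlm (f k l hkl x) = f k m (hkl.trans hlm) x
  injective : ∀ k l (h : k ≤ l), Function.Injective (f k l h)
  hausdorff : T2Space (IndLim E f)

/-- Every compact subset of the inductive limit is contained in a step and is compact there. -/
def IsCompactlyRegular : Prop :=
  ∀ K : Set (IndLim E f), IsCompact K →
    ∃ k : ℤ, K ⊆ Set.range (IndLim.of E f k) ∧ IsCompact (IndLim.of E f k ⁻¹' K)

end InductiveLimit

/-! ### The weighted sequence spaces; the index set `{1, 2, 3, …}` is `ℕ+` -/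

/-- Multiplication of the sequence `x` with the weight `j ^ (-k)`. -/
def weight (k : ℤ) : (ℕ+ → ℂ) →ₗ[ℂ] (ℕ+ → ℂ) where
  toFun x j := ((j : ℕ) : ℂ) ^ (-k) * x j
  map_add' x y := by ext j; simp [mul_add]
  map_smul' c x := by ext j; simp [mul_left_comm]

theorem weight_injective (k : ℤ) : Function.Injective (weight k) := by
  intro x y h
  ext j
  have hj : ((j : ℕ) : ℂ) ^ (-k) ≠ 0 := zpow_ne_zero _ (Nat.cast_ne_zero.2 j.ne_zero)
  exact mul_left_cancel₀ hj (congrFun h j)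

section WeightedLp

variable (p : ℝ≥0∞) (k : ℤ)

/-- `(ℓ^p)_{-k}` as a subspace of `ℂ^ℕ`. -/
def weightedLpSubmodule : Submodule ℂ (ℕ+ → ℂ) where
  carrier := {x | Memℓp (weight k x) p}
  add_mem' {x y} hx hy := by
    change Memℓp (weight k (x + y)) p
    rw [map_add]
    exact Memℓp.add hx hy
  zero_mem' := by
    change Memℓp (weight k 0) p
    rw [map_zero]
    exact zero_memℓp
  smul_mem' c x hx := by
    change Memℓp (weight k (c • x)) p
    rw [map_smul]
    exact Memℓp.const_smul hx c

/-- The space `(ℓ^p)_{-k}` of all sequences `x` such that `(j ^ (-k) * x j)_j` is in `ℓ^p`. -/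
def WeightedLp : Type := weightedLpSubmodule p k

instance : AddCommGroup (WeightedLp p k) := inferInstanceAs (AddCommGroup (weightedLpSubmodule p k))

instance : Module ℂ (WeightedLp p k) := inferInstanceAs (Module ℂ (weightedLpSubmodule p k))

/-- The map `x ↦ (j ^ (-k) * x j)_j` from `(ℓ^p)_{-k}` to `ℓ^p`. -/
def WeightedLp.toLp : WeightedLp p k →ₗ[ℂ] lp (fun _ : ℕ+ => ℂ) p where
  toFun x := ⟨weight k x.1, x.2⟩
  map_add' x y := Subtype.ext ((weight k).map_add x.1 y.1)
  map_smul' c x := Subtype.ext ((weight k).map_smul c x.1)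

theorem WeightedLp.toLp_injective : Function.Injective (WeightedLp.toLp p k) := fun _ _ h =>
  Subtype.ext (weight_injective k (congrArg Subtype.val h))

theorem norm_weight_le {k l : ℤ} (h : k ≤ l) (x : ℕ+ → ℂ) (j : ℕ+) : ‖weight l x j‖ ≤ ‖weight k x j‖ := by
  have hj : (1 : ℝ) ≤ ((j : ℕ) : ℝ) := by exact_mod_cast j.pos
  simp only [weight, LinearMap.coe_mk, AddHom.coe_mk, norm_mul, norm_zpow, Complex.norm_natCast]
  exact mul_le_mul_of_nonneg_right (zpow_le_zpow_right₀ hj (neg_le_neg h)) (norm_nonneg _)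

theorem mem_weightedLp_of_le {k l : ℤ} (h : k ≤ l) {x : ℕ+ → ℂ} (hx : x ∈ weightedLpSubmodule p k) :
    x ∈ weightedLpSubmodule p l :=
  Memℓp.mono' hx (norm_weight_le h x)

variable [Fact (1 ≤ p)]

/-- The norm of `x` in `(ℓ^p)_{-k}` is the `ℓ^p`-norm of `(j ^ (-k) * x j)_j`. -/
instance : NormedAddCommGroup (WeightedLp p k) :=
  NormedAddCommGroup.induced (WeightedLp p k) (lp (fun _ : ℕ+ => ℂ) p) (WeightedLp.toLp p k)
    (WeightedLp.toLp_injective p k)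

instance : NormedSpace ℂ (WeightedLp p k) :=
  NormedSpace.induced ℂ (WeightedLp p k) (lp (fun _ : ℕ+ => ℂ) p) (WeightedLp.toLp p k)

variable {k} {l : ℤ}

/-- The inclusion `(ℓ^p)_{-k} ⊆ (ℓ^p)_{-l}` for `k ≤ l`. -/
def WeightedLp.inclLinear (h : k ≤ l) : WeightedLp p k →ₗ[ℂ] WeightedLp p l :=
  Submodule.inclusion fun _ => mem_weightedLp_of_le p h

theorem WeightedLp.norm_incl_le (h : k ≤ l) (x : WeightedLp p k) :
    ‖WeightedLp.inclLinear p h x‖ ≤ 1 * ‖x‖ := by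
  rw [one_mul]
  change ‖WeightedLp.toLp p l (WeightedLp.inclLinear p h x)‖ ≤ ‖WeightedLp.toLp p k x‖
  exact lp.norm_mono (zero_lt_one.trans_le (Fact.out : 1 ≤ p)).ne' (norm_weight_le h x.1)

/-- The inclusion `(ℓ^p)_{-k} ⊆ (ℓ^p)_{-l}` is continuous. -/
def WeightedLp.incl (h : k ≤ l) : WeightedLp p k →L[ℂ] WeightedLp p l :=
  (WeightedLp.inclLinear p h).mkContinuous 1 (WeightedLp.norm_incl_le p h)

variable (k)

/-- The space `(c_0)_{-k}` of all sequences `x` with `j ^ (-k) * x j → 0`, normed as a subspace of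
`(ℓ^∞)_{-k}`. -/
def WeightedC0 : Submodule ℂ (WeightedLp ∞ k) where
  carrier := {x | Filter.Tendsto (weight k x.1) Filter.cofinite (𝓝 0)}
  add_mem' {x y} hx hy := by
    change Filter.Tendsto (weight k (x.1 + y.1)) Filter.cofinite (𝓝 0)
    rw [map_add, ← add_zero (0 : ℂ)]
    exact Filter.Tendsto.add hx hy
  zero_mem' := by
    change Filter.Tendsto (weight k 0) Filter.cofinite (𝓝 0)
    rw [map_zero]
    exact tendsto_const_nhds
  smul_mem' c x hx := by
    change Filter.Tendsto (weight k (c • x.1)) Filter.cofinite (𝓝 0)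
    rw [map_smul, ← smul_zero c]
    exact Filter.Tendsto.const_smul hx c

variable {k}

/-- The continuous inclusion `(c_0)_{-k} ⊆ (c_0)_{-l}` for `k ≤ l`. -/
def WeightedC0.incl (h : k ≤ l) : WeightedC0 k →L[ℂ] WeightedC0 l :=
  ((WeightedLp.incl ∞ h).comp (WeightedC0 k).subtypeL).codRestrict (WeightedC0 l) fun x =>
    squeeze_zero_norm (norm_weight_le h x.1.1) (tendsto_zero_iff_norm_tendsto_zero.1 x.2)

end WeightedLp

/-! ### The space of rapidly decreasing sequences -/

/-- The sequences `x` such that `(i ^ r * x i)_i` is bounded for all `r`. -/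
def rapidSubmodule : Submodule ℂ (ℕ+ → ℂ) := ⨅ r : ℕ, weightedLpSubmodule ∞ (-(r : ℤ))

/-- The space `s` of rapidly decreasing sequences. -/
def RapidSeq : Type := rapidSubmodule

instance : AddCommGroup RapidSeq := inferInstanceAs (AddCommGroup rapidSubmodule)

instance : Module ℂ RapidSeq := inferInstanceAs (Module ℂ rapidSubmodule)

/-- The inclusion of `s` in the space of all sequences `x` with `(i ^ r * x i)_i` bounded. -/
def RapidSeq.toWeighted (r : ℕ) : RapidSeq →ₗ[ℂ] WeightedLp ∞ (-(r : ℤ)) where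
  toFun x := ⟨x.1, (Submodule.mem_iInf _).1 x.2 r⟩
  map_add' _ _ := rfl
  map_smul' _ _ := rfl

/-- The seminorms `x ↦ sup_i i ^ r * |x i|` of `s`. -/
def rapidSeminorms : SeminormFamily ℂ RapidSeq ℕ := fun r =>
  (normSeminorm ℂ (WeightedLp ∞ (-(r : ℤ)))).comp (RapidSeq.toWeighted r)

instance : TopologicalSpace RapidSeq := rapidSeminorms.moduleFilterBasis.topology

theorem withSeminorms_rapid : WithSeminorms rapidSeminorms := ⟨rfl⟩

/-! ### The two spectra of double sequence spaces -/

section Spectra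

variable (p : ℝ≥0∞) [Fact (1 ≤ p)]

/-- The completed tensor product of `s` and `(ℓ^p)_{-k}`. -/
abbrev LpStep (k : ℤ) : Type := CompletedTensor RapidSeq (WeightedLp p k)

/-- The linking map induced by the inclusion `(ℓ^p)_{-k} ⊆ (ℓ^p)_{-l}`. -/
def lpLink (k l : ℤ) (h : k ≤ l) : LpStep p k →L[ℂ] LpStep p l :=
  CompletedTensor.lTensor RapidSeq (WeightedLp.incl p h)

/-- The completed tensor product of `s` and `(c_0)_{-k}`. -/
abbrev C0Step (k : ℤ) : Type := CompletedTensor RapidSeq (WeightedC0 k)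

/-- The linking map induced by the inclusion `(c_0)_{-k} ⊆ (c_0)_{-l}`. -/
def c0Link (k l : ℤ) (h : k ≤ l) : C0Step k →L[ℂ] C0Step l :=
  CompletedTensor.lTensor RapidSeq (WeightedC0.incl h)

end Spectra

end

/-!
The space `E_k` consists of the double sequences `x` with `i ^ r * |x i j| ≤ C r * j ^ k` for all
`r`, up to a shift of `k` by a fixed amount: since `∑ (i * j) ^ (-2)` converges, all the choices of
`ℓ^p` or `c_0` yield the same inductive limit. Call a weight `v i j ≥ 0` tempered if each product
`v * j ^ k` is dominated by a power of `i`. The maps `x ↦ v * x` into `ℓ¹`, for `v` tempered, are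
continuous on `E`; and they give its topology, because a continuous seminorm `q` satisfies
`q x ≤ ‖v * x‖₁` for the tempered weight `v i j = q (e_i ⊗ e_j)`. The decisive fact is that a family
of double sequences which is bounded against each tempered weight lies in a single step, with
uniform constants `C r`. Applied to one double sequence, it shows that the image of `E` in the
product of the spaces `ℓ¹` is closed, so `E` is complete. Applied to a compact set `K`, it puts `K`
in a set of double sequences that is compact in `ℂ^(ℕ × ℕ)` and, by dominated convergence, in a
step.
-/

noncomputable section

/-! ### Seminorms and locally convex topologies -/

section Seminorms

variable {V W : Type*} [AddCommGroup V] [Module ℂ V] [AddCommGroup W] [Module ℂ W]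

theorem polynormableSpace_complex [TopologicalSpace V] [IsTopologicalAddGroup V]
    [ContinuousSMul ℂ V] [LocallyConvexSpace ℝ V] : PolynormableSpace ℂ V := by
  open scoped ComplexOrder in
  have : LocallyConvexSpace ℂ V := (locallyConvexSpace_iff ℂ V).2 fun x =>
    (LocallyConvexSpace.convex_basis (𝕜 := ℝ) x).to_hasBasis
      (fun s hs => ⟨s, ⟨hs.1, convex_of_nonneg_surjective_algebraMap _
        (fun _ hc => RCLike.nonneg_iff_exists_ofReal.mp hc) hs.2⟩, subset_rfl⟩)
      fun s hs => ⟨s, ⟨hs.1, hs.2.lift ℝ⟩, subset_rfl⟩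
  have : ContinuousSMul ℝ V := IsScalarTower.continuousSMul ℂ
  exact LocallyConvexSpace.toPolynormableSpace

theorem exists_continuous_seminorm_lt_one_imp_mem [TopologicalSpace V] [IsTopologicalAddGroup V]
    [ContinuousSMul ℂ V] [LocallyConvexSpace ℝ V] {U : Set V} (hU : U ∈ 𝓝 0) :
    ∃ p : Seminorm ℂ V, Continuous p ∧ ∀ x, p x < 1 → x ∈ U := by
  have := polynormableSpace_complex (V := V)
  obtain ⟨⟨s, ε⟩, hε, hs⟩ :=
    (PolynormableSpace.withSeminorms ℂ V).hasBasis_zero_ball.mem_iff.1 hU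
  refine ⟨(ε⁻¹).toNNReal • s.sup (fun p : {p : Seminorm ℂ V // Continuous p} => p.1),
    (Seminorm.continuous_finsetSup fun i _ => i.2).const_smul (_ : NNReal), fun x hx => hs ?_⟩
  rw [smul_apply, NNReal.smul_def, Real.coe_toNNReal _ (inv_pos.2 hε).le, smul_eq_mul,
    inv_mul_lt_one₀ hε] at hx
  exact (Seminorm.mem_ball_zero _).2 hx

theorem continuous_of_finestLocallyConvex [TopologicalSpace W] [IsTopologicalAddGroup W]
    [ContinuousSMul ℂ W] [Module ℝ W] [IsScalarTower ℝ ℂ W] [LocallyConvexSpace ℝ W]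
    {P : TopologicalSpace V → Prop} (g : V →ₗ[ℂ] W) (hg : P (.induced g inferInstance)) :
    @Continuous V W (finestLocallyConvex V P) _ g :=
  continuous_iff_le_induced.2 (sInf_le ⟨⟨topologicalAddGroup_induced g, continuousSMul_induced g,
    LocallyConvexSpace.induced (g.restrictScalars ℝ)⟩, hg⟩)

theorem seminorm_le_of_ball_bound (p q : Seminorm ℂ V) {ε M : ℝ} (hε : 0 < ε)
    (h : ∀ x, q x < ε → p x ≤ M) (x : V) : p x ≤ M / ε * q x := by
  have hgt : ∀ t > q x, p x ≤ M / ε * t := fun t ht => by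
    have ht0 : 0 < t := (apply_nonneg q x).trans_lt ht
    have hnorm : ‖((ε / t : ℝ) : ℂ)‖ = ε / t := by
      rw [Complex.norm_real, Real.norm_of_nonneg (by positivity)]
    have hscaled := h (((ε / t : ℝ) : ℂ) • x) (by
      rw [map_smul_eq_mul, hnorm, div_mul_eq_mul_div, div_lt_iff₀ ht0]
      gcongr)
    rw [map_smul_eq_mul, hnorm, ← le_div_iff₀' (by positivity)] at hscaled
    exact hscaled.trans_eq (by field_simp)
  exact ge_of_tendsto
    ((continuous_const_mul (M / ε)).continuousWithinAt (s := Set.Ioi (q x)) (x := q x))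
    (Filter.eventually_of_mem self_mem_nhdsWithin hgt)

theorem exists_seminorm_bilinear_le {F κ : Type*} [TopologicalSpace V] [TopologicalSpace W]
    [SeminormedAddCommGroup F] [NormedSpace ℂ F] {q : SeminormFamily ℂ V κ} (hq : WithSeminorms q)
    (B : V →ₗ[ℂ] F →ₗ[ℂ] W) (hB : Continuous fun x : V × F => B x.1 x.2) {p : Seminorm ℂ W}
    (hp : Continuous p) :
    ∃ (s : Finset κ) (C : ℝ), 0 ≤ C ∧ ∀ a y, p (B a y) ≤ C * s.sup q a * ‖y‖ := by
  have hlt : {x : V × F | p (B x.1 x.2) < 1} ∈ 𝓝 (0 : V) ×ˢ 𝓝 (0 : F) := by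
    rw [← nhds_prod_eq]
    exact ((hp.comp hB).tendsto (0, 0)).eventually_lt_const (by simp)
  obtain ⟨⟨⟨s, ε⟩, δ⟩, ⟨hε, hδ⟩, hs⟩ :=
    (hq.hasBasis_zero_ball.prod Metric.nhds_basis_ball).mem_iff.1 hlt
  have hsmall : ∀ y, ‖y‖ < δ → ∀ a, p (B a y) ≤ 1 / ε * s.sup q a := fun y hy =>
    seminorm_le_of_ball_bound (p.comp (B.flip y)) (s.sup q) hε fun a ha =>
      le_of_lt (hs (Set.mk_mem_prod ((Seminorm.mem_ball_zero _).2 ha) (mem_ball_zero_iff.2 hy)))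
  refine ⟨s, 1 / ε / δ, by positivity, fun a y => ?_⟩
  exact (seminorm_le_of_ball_bound (p.comp (B a)) (normSeminorm ℂ F) hδ
    (fun y hy => hsmall y hy a) y).trans_eq (by rw [coe_normSeminorm]; ring)

theorem seminorm_le_tsum_of_hasSum {ι : Type*} [TopologicalSpace V] {p : Seminorm ℂ V}
    (hp : Continuous p) {v : ι → V} {x : V} (hv : HasSum v x) (hs : Summable fun i => p (v i)) :
    p x ≤ ∑' i, p (v i) :=
  le_of_tendsto' ((hp.tendsto x).comp hv) fun s =>
    (Finset.le_sum_of_subadditive p (map_zero p).le (map_add_le_add p) s v).trans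
      (hs.sum_le_tsum s fun _ _ => apply_nonneg p _)

theorem summable_of_summable_seminorm {ι κ : Type*} [UniformSpace V] [IsUniformAddGroup V]
    [CompleteSpace V] {p : SeminormFamily ℂ V κ} (hp : WithSeminorms p) {v : ι → V}
    (hv : ∀ r, Summable fun i => p r (v i)) : Summable v := by
  rw [summable_iff_cauchySeq_finset, cauchySeq_finset_iff_sum_vanishing]
  intro e he
  obtain ⟨⟨s, ε⟩, hε, hs⟩ := hp.hasBasis_zero_ball.mem_iff.1 he
  have hsum : Summable fun i => ∑ r ∈ s, p r (v i) := summable_sum fun r _ => hv r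
  obtain ⟨t, ht⟩ := summable_iff_vanishing_norm.1 hsum ε hε
  refine ⟨t, fun t' htt' => hs ((Seminorm.mem_ball_zero _).2 ?_)⟩
  calc s.sup p (∑ i ∈ t', v i)
      ≤ ∑ i ∈ t', s.sup p (v i) :=
        Finset.le_sum_of_subadditive _ (map_zero _).le (map_add_le_add _) t' v
    _ ≤ ∑ i ∈ t', ∑ r ∈ s, p r (v i) := Finset.sum_le_sum fun i _ =>
        Seminorm.finset_sup_apply_le (Finset.sum_nonneg fun r _ => apply_nonneg _ _) fun r hr =>
          Finset.single_le_sum (f := fun r => p r (v i)) (fun r _ => apply_nonneg _ _) hr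
    _ ≤ ‖∑ i ∈ t', ∑ r ∈ s, p r (v i)‖ := Real.le_norm_self _
    _ < ε := ht t' htt'

theorem withSeminorms_fromCompletion {κ : Type*} {Y : κ → Type*} [UniformSpace V]
    [IsUniformAddGroup V] [UniformContinuousConstSMul ℂ V] [∀ r, NormedAddCommGroup (Y r)]
    [∀ r, NormedSpace ℂ (Y r)] [∀ r, CompleteSpace (Y r)] (T : ∀ r, V →L[ℂ] Y r)
    (hT : ∀ U ∈ 𝓝 (0 : V), ∃ r, ∃ ε > 0, ∀ z, ‖T r z‖ < ε → z ∈ U) :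
    WithSeminorms fun r : κ =>
      (normSeminorm ℂ (Y r)).comp (T r).fromCompletion.toLinearMap := by
  have hcont : ∀ r, Continuous fun x => ‖(T r).fromCompletion x‖ :=
    fun r => (T r).fromCompletion.continuous.norm
  rw [SeminormFamily.withSeminorms_iff_nhds_eq_iInf]
  refine le_antisymm (le_iInf fun r => Filter.tendsto_iff_comap.1
    ((hcont r).tendsto' 0 0 (by rw [map_zero, norm_zero]))) fun U hU => ?_
  obtain ⟨K, ⟨hK, hKclosed⟩, hKU⟩ :=
    (closed_nhds_basis (0 : UniformSpace.Completion V)).mem_iff.1 hU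
  obtain ⟨r, ε, hε, hball⟩ := hT _
    ((UniformSpace.Completion.continuous_coe V).tendsto' 0 0 UniformSpace.Completion.coe_zero hK)
  refine Filter.mem_iInf_of_mem r (Filter.mem_of_superset
    (Filter.preimage_mem_comap (Iio_mem_nhds hε)) fun x hx => hKU ?_)
  have hclosure := UniformSpace.Completion.denseRange_coe.subset_closure_image_preimage_of_isOpen
    (isOpen_Iio.preimage (hcont r)) hx
  refine hKclosed.closure_subset_iff.2 ?_ hclosure
  rintro _ ⟨z, hz, rfl⟩
  refine hball z ?_
  rwa [Set.mem_preimage, Set.mem_preimage, (T r).fromCompletion_apply_coe] at hz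

end Seminorms

/-! ### Tempered weights -/

section TemperedWeights

variable {ι : Type*} {α β : ι → ℝ}

/-- The weights `v` for which every `v * β ^ k` is dominated by a power of `α`. Against such a
weight, all sequences `x` with `α ^ r * ‖x‖ ≤ C r * β ^ n` for all `r` are bounded. -/
def IsTempered (α β v : ι → ℝ) : Prop :=
  (∀ i, 0 ≤ v i) ∧ ∀ k : ℕ, ∃ (r : ℕ) (C : ℝ), ∀ i, v i * β i ^ k ≤ C * α i ^ r

/-- The sequences `x` with `α ^ r * ‖x‖ ≤ C r * β ^ n` for all `r`. -/
def rapidBox (α β : ι → ℝ) (C : ℕ → ℝ) (n : ℕ) : Set (ι → ℂ) :=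
  {x | ∀ r i, α i ^ r * ‖x i‖ ≤ C r * β i ^ n}

theorem isTempered_indicator_le (hα : ∀ i, 0 ≤ α i) (hβ : ∀ i, 0 ≤ β i) (r : ℕ) :
    IsTempered α β ({i | β i ≤ α i ^ r}.indicator fun i => α i ^ r) := by
  refine ⟨fun i => Set.indicator_nonneg (fun i _ => pow_nonneg (hα i) r) i, fun k =>
    ⟨r + r * k, 1, fun i => ?_⟩⟩
  by_cases hi : β i ≤ α i ^ r
  · rw [Set.indicator_of_mem (by exact hi), one_mul, pow_add, pow_mul]
    exact mul_le_mul_of_nonneg_left (pow_le_pow_left₀ (hβ i) hi k) (pow_nonneg (hα i) r)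
  · rw [Set.indicator_of_notMem (by exact hi), zero_mul, one_mul]
    exact pow_nonneg (hα i) _

theorem exists_isTempered_le (hβ : ∀ i, 0 ≤ β i) {w : ℕ → ℝ} (hw : ∀ n, 0 ≤ w n) (i : ℕ → ι)
    (hbdd : ∀ k : ℕ, BddAbove (Set.range fun n => w n * β (i n) ^ k)) :
    ∃ v, IsTempered α β v ∧ ∀ n, w n ≤ v (i n) := by
  refine ⟨fun j => ⨆ n : {n // i n = j}, w n,
    ⟨fun j => Real.iSup_nonneg fun n => hw n, fun k => ?_⟩, fun n => ?_⟩
  · obtain ⟨M, hM⟩ := hbdd k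
    have hM0 : 0 ≤ M := (mul_nonneg (hw 0) (pow_nonneg (hβ _) k)).trans (hM ⟨0, rfl⟩)
    refine ⟨0, M, fun j => ?_⟩
    rw [pow_zero, mul_one, Real.iSup_mul_of_nonneg (pow_nonneg (hβ j) k)]
    refine Real.iSup_le ?_ hM0
    rintro ⟨n, rfl⟩
    exact hM ⟨n, rfl⟩
  · obtain ⟨M, hM⟩ := hbdd 0
    refine le_ciSup (f := fun m : {m // i m = i n} => w m) ⟨M, ?_⟩ ⟨n, rfl⟩
    rintro _ ⟨m, rfl⟩
    simpa only [pow_zero, mul_one] using hM ⟨m, rfl⟩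

theorem bddAbove_range_div_pow_mul_pow {w b : ℕ → ℝ} (hb : ∀ n, 1 ≤ b n) (hw : ∀ n, w n ≤ b n)
    (k : ℕ) : BddAbove (Set.range fun n => w n / b n ^ n * b n ^ k) := by
  refine Filter.IsBoundedUnder.bddAbove_range ⟨1, Filter.eventually_map.2 ?_⟩
  filter_upwards [Filter.eventually_ge_atTop (k + 1)] with n hn
  have hpos : 0 < b n := zero_lt_one.trans_le (hb n)
  rw [div_mul_eq_mul_div, div_le_one (by positivity)]
  calc w n * b n ^ k ≤ b n * b n ^ k := by gcongr; exact hw n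
    _ = b n ^ (k + 1) := (pow_succ' _ _).symm
    _ ≤ b n ^ n := pow_le_pow_right₀ (hb n) hn

/-- If no single step contained the family, there would be `r n`, `t n` and `i n` with
`α ^ r n * ‖X‖ > n * β ^ n` at `(t n, i n)`. The indicator weights force `α ^ r n < β` there, so a
weight taking values at least `α ^ r n / β ^ n` at the `i n` can be chosen tempered. -/
theorem exists_rapidBox_of_tempered_bound (hα : ∀ i, 0 ≤ α i) (hβ : ∀ i, 1 ≤ β i) {T : Type*}
    (X : T → ι → ℂ) (h : ∀ v, IsTempered α β v → ∃ C, ∀ t i, v i * ‖X t i‖ ≤ C) :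
    ∃ C n, ∀ t, X t ∈ rapidBox α β C n := by
  suffices hn : ∃ n : ℕ, ∀ r : ℕ, ∃ C : ℝ, ∀ t i, α i ^ r * ‖X t i‖ ≤ C * β i ^ n by
    obtain ⟨n, hn⟩ := hn
    choose C hC using hn
    exact ⟨C, n, fun t r => hC r t⟩
  by_contra! hcon
  have hβ0 : ∀ i, 0 < β i := fun i => zero_lt_one.trans_le (hβ i)
  choose r hr using hcon
  choose B hB using fun n => h _ (isTempered_indicator_le hα (fun i => (hβ0 i).le) (r n))
  choose t i hlarge using fun n : ℕ => hr n (max (B n) n)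
  have hlt : ∀ n, α (i n) ^ r n < β (i n) := fun n => by
    by_contra! hle
    have hbound := hB n (t n) (i n)
    rw [Set.indicator_of_mem (by exact hle)] at hbound
    refine (hlarge n).not_ge (hbound.trans ((le_max_left _ (n : ℝ)).trans ?_))
    exact le_mul_of_one_le_right (le_max_of_le_right n.cast_nonneg) (one_le_pow₀ (hβ _))
  obtain ⟨v, hv, hle⟩ := exists_isTempered_le (α := α) (fun i => (hβ0 i).le)
    (fun n => div_nonneg (pow_nonneg (hα _) _) (pow_nonneg (hβ0 _).le n)) i
    (bddAbove_range_div_pow_mul_pow (fun n => hβ (i n)) fun n => (hlt n).le)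
  obtain ⟨C, hC⟩ := h v hv
  obtain ⟨n, hn⟩ := exists_nat_gt C
  have hpos : 0 < β (i n) ^ n := pow_pos (hβ0 _) n
  have hsmall : α (i n) ^ r n * ‖X (t n) (i n)‖ ≤ C * β (i n) ^ n := by
    rw [← div_le_iff₀ hpos, ← div_mul_eq_mul_div]
    exact (mul_le_mul_of_nonneg_right (hle n) (norm_nonneg _)).trans (hC _ _)
  refine (hlarge n).not_ge (hsmall.trans ?_)
  exact mul_le_mul_of_nonneg_right (hn.le.trans (le_max_right _ _)) hpos.le

theorem isCompact_rapidBox (α β : ι → ℝ) (C : ℕ → ℝ) (n : ℕ) : IsCompact (rapidBox α β C n) := by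
  refine (isCompact_univ_pi fun i =>
    isCompact_closedBall (0 : ℂ) (C 0 * β i ^ n)).of_isClosed_subset ?_ fun x hx i _ => ?_
  · simp only [rapidBox, Set.ofPred_forall]
    refine isClosed_iInter fun r => isClosed_iInter fun i => isClosed_le ?_ continuous_const
    fun_prop
  · simpa using hx 0 i

theorem mul_le_mul_inv_pow_of_le {u t a b c M : ℝ} {r n m : ℕ} (ht : 0 ≤ t) (ha : 0 < a)
    (hb : 0 < b) (hc : 0 ≤ c) (hu : u * b ^ (n + m) ≤ c * a ^ r)
    (hM : a ^ (r + m) * t ≤ M * b ^ n) : u * t ≤ c * M * ((a * b) ^ m)⁻¹ := by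
  rw [← div_eq_mul_inv, le_div_iff₀ (by positivity)]
  refine le_of_mul_le_mul_right ?_ (pow_pos hb n)
  calc u * t * (a * b) ^ m * b ^ n = u * b ^ (n + m) * (a ^ m * t) := by ring
    _ ≤ c * a ^ r * (a ^ m * t) := by gcongr
    _ = c * (a ^ (r + m) * t) := by ring
    _ ≤ c * (M * b ^ n) := by gcongr
    _ = c * M * b ^ n := by ring

/-- Summability of `(α * β) ^ (-m)` for weights `α, β ≥ 1`. It makes weighted suprema of
sequences comparable with weighted `ℓ¹`-norms, at the cost of raising the exponents by `m`. -/
structure IsNuclearPair (α β : ι → ℝ) (m : ℕ) : Prop where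
  one_le_left : ∀ i, 1 ≤ α i
  one_le_right : ∀ i, 1 ≤ β i
  summable : Summable fun i => ((α i * β i) ^ m)⁻¹

namespace IsNuclearPair

variable {m : ℕ} (h : IsNuclearPair α β m)
include h

theorem left_pos (i : ι) : 0 < α i := zero_lt_one.trans_le (h.one_le_left i)

theorem right_pos (i : ι) : 0 < β i := zero_lt_one.trans_le (h.one_le_right i)

theorem tsum_nonneg : 0 ≤ ∑' i, ((α i * β i) ^ m)⁻¹ :=
  _root_.tsum_nonneg fun i =>
    inv_nonneg.2 (pow_nonneg (mul_pos (h.left_pos i) (h.right_pos i)).le m)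

theorem exists_mul_norm_le {v : ι → ℝ} (hv : IsTempered α β v) (n : ℕ) :
    ∃ (r : ℕ) (c : ℝ), 0 ≤ c ∧ ∀ C, ∀ x ∈ rapidBox α β C n, ∀ i,
      v i * ‖x i‖ ≤ c * C r * ((α i * β i) ^ m)⁻¹ := by
  obtain ⟨r, c, hc⟩ := hv.2 (n + m)
  refine ⟨r + m, max c 0, le_max_right _ _, fun C x hx i => ?_⟩
  exact mul_le_mul_inv_pow_of_le (norm_nonneg _) (h.left_pos i) (h.right_pos i) (le_max_right _ _)
    ((hc i).trans (mul_le_mul_of_nonneg_right (le_max_left _ _) (pow_nonneg (h.left_pos i).le r)))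
    (hx (r + m) i)

theorem memℓp_one_of_mem_rapidBox {v : ι → ℝ} (hv : IsTempered α β v) {C : ℕ → ℝ} {n : ℕ}
    {x : ι → ℂ} (hx : x ∈ rapidBox α β C n) : Memℓp (fun i => (v i : ℂ) * x i) 1 := by
  obtain ⟨r, c, -, hle⟩ := h.exists_mul_norm_le hv n
  refine memℓp_gen ?_
  simp only [ENNReal.toReal_one, Real.rpow_one, norm_mul, Complex.norm_of_nonneg (hv.1 _)]
  exact (h.summable.mul_left (c * C r)).of_nonneg_of_le
    (fun i => mul_nonneg (hv.1 i) (norm_nonneg _)) (hle C x hx)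

end IsNuclearPair

end TemperedWeights

/-! ### Sequence spaces with power weights -/

section PowerCoordinates

variable {ι : Type*} {α β : ι → ℝ}

theorem sub_mem_rapidBox (hα : ∀ i, 0 ≤ α i) {C C' : ℕ → ℝ} {n : ℕ} {x y : ι → ℂ}
    (hx : x ∈ rapidBox α β C n) (hy : y ∈ rapidBox α β C' n) : x - y ∈ rapidBox α β (C + C') n := by
  intro r i
  calc α i ^ r * ‖(x - y) i‖ ≤ α i ^ r * (‖x i‖ + ‖y i‖) :=
        mul_le_mul_of_nonneg_left (norm_sub_le _ _) (pow_nonneg (hα i) r)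
    _ ≤ (C + C') r * β i ^ n := by
        rw [mul_add, Pi.add_apply, add_mul]
        exact add_le_add (hx r i) (hy r i)

/-- A realization of `V` as a space of sequences with topology given by seminorms that behave like
`sup α ^ r * β ^ (-k) * ‖x‖` on the coordinates and on the unit vectors. -/
structure PowerCoordinates [DecidableEq ι] (α β : ι → ℝ) (k : ℤ) (V : Type*) [AddCommGroup V]
    [Module ℂ V] [UniformSpace V] where
  seminorm : SeminormFamily ℂ V ℕ
  withSeminorms : WithSeminorms seminorm
  coord : V →ₗ[ℂ] (ι → ℂ)
  unit : ι → V
  coord_injective : Function.Injective coord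
  coord_unit : ∀ i, coord (unit i) = Pi.single i 1
  coord_le : ∀ r x i, α i ^ r * ‖coord x i‖ ≤ β i ^ k * seminorm r x
  seminorm_unit_le : ∀ r i, seminorm r (unit i) ≤ α i ^ r * β i ^ (-k)

namespace PowerCoordinates

variable [DecidableEq ι] {k : ℤ} {n m : ℕ} {V : Type*} [AddCommGroup V] [Module ℂ V]
  [UniformSpace V]

theorem continuous_coord (D : PowerCoordinates α β k V) : Continuous D.coord := by
  refine continuous_pi fun i => D.withSeminorms.continuous_normedSpace_rng ℂ
    ((LinearMap.proj i : (ι → ℂ) →ₗ[ℂ] ℂ).comp D.coord) ⟨{0}, (β i ^ k).toNNReal, fun x => ?_⟩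
  have hle := D.coord_le 0 x i
  rw [pow_zero, one_mul] at hle
  simpa [NNReal.smul_def] using
    hle.trans (mul_le_mul_of_nonneg_right (Real.le_coe_toNNReal _) (apply_nonneg _ _))

theorem isFrechetSpace [IsUniformAddGroup V] [CompleteSpace V] (D : PowerCoordinates α β k V) :
    IsFrechetSpace V := by
  have : T2Space V := T2Space.of_injective_continuous D.coord_injective D.continuous_coord
  have := D.withSeminorms.firstCountableTopology
  have : (uniformity V).IsCountablyGenerated := IsUniformAddGroup.uniformity_countably_generated
  exact ⟨inferInstance, D.withSeminorms.continuousSMul, D.withSeminorms.toLocallyConvexSpace,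
    UniformSpace.metrizableSpace, inferInstance⟩

theorem exists_seminorm_unit_le (D : PowerCoordinates α β k V) (hα : ∀ i, 1 ≤ α i)
    (hβ : ∀ i, 0 < β i) {p : Seminorm ℂ V} (hp : Continuous p) :
    ∃ (r : ℕ) (C : ℝ), ∀ i, p (D.unit i) ≤ C * (α i ^ r * β i ^ (-k)) := by
  obtain ⟨s, C, -, hle⟩ := Seminorm.bound_of_continuous D.withSeminorms p hp
  have hαβ : ∀ r i, 0 ≤ α i ^ r * β i ^ (-k) := fun r i =>
    mul_nonneg (pow_nonneg (zero_le_one.trans (hα i)) r) (zpow_nonneg (hβ i).le _)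
  refine ⟨s.sup id, C, fun i => (hle _).trans ?_⟩
  rw [smul_apply, NNReal.smul_def, smul_eq_mul]
  refine mul_le_mul_of_nonneg_left (Seminorm.finset_sup_apply_le (hαβ _ i) fun r hr =>
    (D.seminorm_unit_le r i).trans (mul_le_mul_of_nonneg_right ?_ (zpow_nonneg (hβ i).le _))) C.2
  exact pow_le_pow_right₀ (hα i) (Finset.le_sup (f := id) hr)

theorem coord_mem_rapidBox (D : PowerCoordinates α β (n : ℤ) V) (x : V) :
    D.coord x ∈ rapidBox α β (fun r => D.seminorm r x) n := fun r i => by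
  rw [mul_comm (D.seminorm r x), ← zpow_natCast (β i)]
  exact D.coord_le r x i

section OfCoord

variable (h : IsNuclearPair α β m) (D : PowerCoordinates α β ((n + m : ℕ) : ℤ) V) {C : ℕ → ℝ}
  {x y : ι → ℂ}

/-- The element with the given coordinates. -/
def ofCoord (D : PowerCoordinates α β k V) (x : ι → ℂ) : V := ∑' i, x i • D.unit i

include h

theorem seminorm_smul_unit_le (hx : x ∈ rapidBox α β C n) (r : ℕ) (i : ι) :
    D.seminorm r (x i • D.unit i) ≤ C (r + m) * ((α i * β i) ^ m)⁻¹ := by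
  rw [map_smul_eq_mul, mul_comm, ← one_mul (C (r + m))]
  refine mul_le_mul_inv_pow_of_le (norm_nonneg _) (h.left_pos i) (h.right_pos i) zero_le_one ?_
    (hx (r + m) i)
  rw [one_mul, ← le_div_iff₀ (pow_pos (h.right_pos i) _), div_eq_mul_inv, ← zpow_natCast (β i),
    ← zpow_neg]
  exact D.seminorm_unit_le r i

theorem summable_seminorm_smul_unit (hx : x ∈ rapidBox α β C n) (r : ℕ) :
    Summable fun i => D.seminorm r (x i • D.unit i) :=
  (h.summable.mul_left (C (r + m))).of_nonneg_of_le (fun _ => apply_nonneg _ _)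
    (D.seminorm_smul_unit_le h hx r)

variable [IsUniformAddGroup V] [CompleteSpace V]

theorem hasSum_ofCoord (hx : x ∈ rapidBox α β C n) :
    HasSum (fun i => x i • D.unit i) (D.ofCoord x) :=
  (summable_of_summable_seminorm D.withSeminorms (D.summable_seminorm_smul_unit h hx)).hasSum

theorem coord_ofCoord (hx : x ∈ rapidBox α β C n) : D.coord (D.ofCoord x) = x := by
  funext j
  have hsum : HasSum (fun i => D.coord (x i • D.unit i) j) (D.coord (D.ofCoord x) j) :=
    (D.hasSum_ofCoord h hx).map ((LinearMap.proj j).comp D.coord)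
      ((continuous_apply j).comp D.continuous_coord)
  refine hsum.unique ?_
  convert hasSum_single j fun i (hi : i ≠ j) => ?_ using 1
  · rw [map_smul, D.coord_unit, Pi.smul_apply, Pi.single_eq_same, smul_eq_mul, mul_one]
  · rw [map_smul, D.coord_unit, Pi.smul_apply, Pi.single_eq_of_ne' hi, smul_zero]

theorem seminorm_ofCoord_sub_le (hx : x ∈ rapidBox α β C n) (hy : y ∈ rapidBox α β C n) (r : ℕ) :
    D.seminorm r (D.ofCoord x - D.ofCoord y) ≤ ∑' i, D.seminorm r ((x - y) i • D.unit i) := by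
  refine seminorm_le_tsum_of_hasSum (D.withSeminorms.continuous_seminorm r) ?_
    (D.summable_seminorm_smul_unit h (sub_mem_rapidBox (fun i => (h.left_pos i).le) hx hy) r)
  simp only [Pi.sub_apply, sub_smul]
  exact (D.hasSum_ofCoord h hx).sub (D.hasSum_ofCoord h hy)

theorem continuousOn_ofCoord (C : ℕ → ℝ) : ContinuousOn D.ofCoord (rapidBox α β C n) := by
  intro y hy
  rw [ContinuousWithinAt, D.withSeminorms.tendsto_nhds]
  intro r ε hε
  have hlim : Filter.Tendsto (fun x => ∑' i, D.seminorm r ((x - y) i • D.unit i))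
      (𝓝[rapidBox α β C n] y) (𝓝 (∑' i, D.seminorm r ((y - y) i • D.unit i))) := by
    refine tendsto_tsum_of_dominated_convergence (h.summable.mul_left ((C + C) (r + m)))
      (fun i => Filter.Tendsto.mono_left ?_ nhdsWithin_le_nhds) ?_
    · refine Continuous.tendsto (f := fun x => D.seminorm r ((x - y) i • D.unit i)) ?_ y
      simp only [map_smul_eq_mul]
      fun_prop
    · filter_upwards [self_mem_nhdsWithin] with x hx i
      rw [Real.norm_of_nonneg (apply_nonneg _ _)]
      exact D.seminorm_smul_unit_le h (sub_mem_rapidBox (fun i => (h.left_pos i).le) hx hy) r i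
  simp only [sub_self, Pi.zero_apply, zero_smul, map_zero, tsum_zero] at hlim
  filter_upwards [hlim.eventually_lt_const hε, self_mem_nhdsWithin] with x hx hxC
  exact (D.seminorm_ofCoord_sub_le h hxC hy r).trans_lt hx

end OfCoord

end PowerCoordinates

end PowerCoordinates

/-! ### Inductive limits of sequence spaces -/

section InductiveLimits

theorem isTempered_single {ι : Type*} [DecidableEq ι] {α β : ι → ℝ} (hβ : ∀ i, 0 ≤ β i) (i : ι) :
    IsTempered α β (Pi.single i 1) := by
  refine ⟨(Pi.single_nonneg (α := fun _ : ι => ℝ)).2 zero_le_one,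
    fun k => ⟨0, β i ^ k, fun j => ?_⟩⟩
  obtain rfl | hj := eq_or_ne j i
  · rw [Pi.single_eq_same, one_mul, pow_zero, mul_one]
  · rw [Pi.single_eq_of_ne hj, zero_mul, pow_zero, mul_one]
    exact pow_nonneg (hβ i) k

variable {E : ℤ → Type*} [∀ k, AddCommGroup (E k)] [∀ k, Module ℂ (E k)]
  [∀ k, UniformSpace (E k)] {f : ∀ k l : ℤ, k ≤ l → E k →L[ℂ] E l}

namespace IndLim

theorem of_apply {k l : ℤ} (hkl : k ≤ l) (x : E k) : of E f l (f k l hkl x) = of E f k x :=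
  Module.DirectLimit.of_f

theorem exists_of (x : IndLim E f) : ∃ k y, of E f k y = x :=
  Module.DirectLimit.exists_of x

theorem exists_of_natCast (x : IndLim E f) : ∃ (n : ℕ) (y : E n), of E f n y = x := by
  obtain ⟨k, y, rfl⟩ := exists_of x
  exact ⟨k.toNat, f k _ (Int.self_le_toNat k) y, of_apply _ _⟩

theorem continuous_of (k : ℤ) : Continuous (of E f k) :=
  continuous_sInf_rng.2 fun _ ht => ht.2 k

theorem continuous_of_comp_natCast {W : Type*} [AddCommGroup W] [Module ℂ W] [TopologicalSpace W]
    [IsTopologicalAddGroup W] [ContinuousSMul ℂ W] [Module ℝ W] [IsScalarTower ℝ ℂ W]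
    [LocallyConvexSpace ℝ W] (g : IndLim E f →ₗ[ℂ] W)
    (hg : ∀ n : ℕ, Continuous fun x : E n => g (of E f n x)) : Continuous g := by
  refine continuous_of_finestLocallyConvex g fun k => continuous_induced_rng.2 ?_
  refine ((hg k.toNat).comp (f k _ (Int.self_le_toNat k)).continuous).congr fun x => ?_
  rw [Function.comp_apply, of_apply, Function.comp_apply]

variable {ι : Type*} [DecidableEq ι] {α β : ι → ℝ} {m : ℕ} (D : ∀ k, PowerCoordinates α β k (E k))
  (hD : ∀ k l hkl x, (D l).coord (f k l hkl x) = (D k).coord x)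

/-- The coordinates on the inductive limit, for coordinates `D k` on the steps `E k` that are
compatible with the linking maps. -/
def coord : IndLim E f →ₗ[ℂ] (ι → ℂ) :=
  Module.DirectLimit.lift ℂ ℤ E (fun k l h => (f k l h).toLinearMap) (fun k => (D k).coord) hD

theorem coord_of (k : ℤ) (x : E k) : coord D hD (of E f k x) = (D k).coord x :=
  Module.DirectLimit.lift_of _ _ x

theorem coord_injective : Function.Injective (coord D hD) := by
  refine (injective_iff_map_eq_zero _).2 fun x hx => ?_
  obtain ⟨k, y, rfl⟩ := exists_of x
  rw [coord_of] at hx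
  rw [(D k).coord_injective (hx.trans (map_zero _).symm), map_zero]

theorem exists_coord_mem_rapidBox (x : IndLim E f) : ∃ C n, coord D hD x ∈ rapidBox α β C n := by
  obtain ⟨n, y, rfl⟩ := exists_of_natCast x
  rw [coord_of]
  exact ⟨_, n, (D n).coord_mem_rapidBox y⟩

include hD in
theorem of_unit (k l : ℤ) (i : ι) : of E f k ((D k).unit i) = of E f l ((D l).unit i) :=
  coord_injective D hD (by rw [coord_of, coord_of, (D k).coord_unit, (D l).coord_unit])

variable (h : IsNuclearPair α β m) {v : ι → ℝ} (hv : IsTempered α β v)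

/-- The map `x ↦ v * x` into `ℓ¹`, for a tempered weight `v`. -/
def toL1 : IndLim E f →ₗ[ℂ] lp (fun _ : ι => ℂ) 1 where
  toFun x := ⟨fun i => v i * coord D hD x i, by
    obtain ⟨C, n, hx⟩ := exists_coord_mem_rapidBox D hD x
    exact h.memℓp_one_of_mem_rapidBox hv hx⟩
  map_add' x y := lp.ext (funext fun i => by
    simp only [map_add, Pi.add_apply, mul_add]; rfl)
  map_smul' c x := by ext i; simp [mul_left_comm]

theorem toL1_apply (x : IndLim E f) (i : ι) : toL1 D hD h hv x i = v i * coord D hD x i := rfl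

theorem norm_toL1_apply (x : IndLim E f) (i : ι) :
    ‖toL1 D hD h hv x i‖ = v i * ‖coord D hD x i‖ := by
  rw [toL1_apply, norm_mul, Complex.norm_of_nonneg (hv.1 i)]

theorem hasSum_norm_toL1 (x : IndLim E f) :
    HasSum (fun i => v i * ‖coord D hD x i‖) ‖toL1 D hD h hv x‖ := by
  simp only [← norm_toL1_apply D hD h hv]
  rw [lp.norm_eq_tsum_rpow (by simp)]
  simp only [ENNReal.toReal_one, Real.rpow_one, div_one]
  exact (lp.memℓp (toL1 D hD h hv x)).summable_of_one.norm.hasSum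

theorem continuous_toL1 : Continuous (toL1 D hD h hv) := by
  refine continuous_of_comp_natCast _ fun n => ?_
  obtain ⟨r, c, hc, hle⟩ := h.exists_mul_norm_le hv n
  refine (D n).withSeminorms.continuous_normedSpace_rng _ ((toL1 D hD h hv).comp (of E f n))
    ⟨{r}, (c * ∑' i, ((α i * β i) ^ m)⁻¹).toNNReal, fun x => ?_⟩
  have hbound := hasSum_le (hle _ _ ((D n).coord_mem_rapidBox x))
    (coord_of D hD n x ▸ hasSum_norm_toL1 D hD h hv (of E f n x)) (h.summable.hasSum.mul_left _)
  rw [Finset.sup_singleton, Seminorm.comp_apply, smul_apply, NNReal.smul_def, smul_eq_mul,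
    Real.coe_toNNReal _ (mul_nonneg hc h.tsum_nonneg), mul_right_comm]
  exact hbound

theorem toL1_single_apply_self (i : ι) (x : IndLim E f) :
    toL1 D hD h (isTempered_single (fun i => (h.right_pos i).le) i) x i = coord D hD x i := by
  rw [toL1_apply, Pi.single_eq_same, Complex.ofReal_one, one_mul]

include h in
theorem continuous_coord : Continuous (coord D hD) := by
  refine continuous_pi fun i => ?_
  simp only [← toL1_single_apply_self D hD h i]
  exact (lp.evalCLM ℂ (fun _ : ι => ℂ) 1 i).continuous.comp
    (continuous_toL1 D hD h (isTempered_single (fun i => (h.right_pos i).le) i))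

include h hD in
theorem t2Space : T2Space (IndLim E f) :=
  T2Space.of_injective_continuous (coord_injective D hD) (continuous_coord D hD h)

include h hD in
theorem isTempered_seminorm_unit {q : Seminorm ℂ (IndLim E f)} (hq : Continuous q) :
    IsTempered α β fun i => q (of E f 0 ((D 0).unit i)) := by
  refine ⟨fun i => apply_nonneg q _, fun k => ?_⟩
  obtain ⟨r, C, hle⟩ := (D k).exists_seminorm_unit_le h.one_le_left h.right_pos
    (p := q.comp (of E f k)) (hq.comp (continuous_of (k : ℤ)))
  refine ⟨r, C, fun i => ?_⟩
  change q (of E f 0 ((D 0).unit i)) * β i ^ k ≤ C * α i ^ r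
  rw [← le_div_iff₀ (pow_pos (h.right_pos i) k), ← of_unit D hD k 0, div_eq_mul_inv, mul_assoc,
    ← zpow_natCast (β i), ← zpow_neg]
  exact hle i

variable [∀ k, IsUniformAddGroup (E k)] [∀ k, CompleteSpace (E k)]

include h in
theorem of_ofCoord {C : ℕ → ℝ} {n : ℕ} {x : IndLim E f} (hx : coord D hD x ∈ rapidBox α β C n) :
    of E f (n + m : ℕ) ((D (n + m : ℕ)).ofCoord (coord D hD x)) = x :=
  coord_injective D hD (by rw [coord_of, (D _).coord_ofCoord h hx])

theorem seminorm_le_norm_toL1 {q : Seminorm ℂ (IndLim E f)} (hq : Continuous q) (x : IndLim E f) :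
    q x ≤ ‖toL1 D hD h (isTempered_seminorm_unit D hD h hq) x‖ := by
  obtain ⟨C, n, hx⟩ := exists_coord_mem_rapidBox D hD x
  have hsum : HasSum (fun i => coord D hD x i • of E f 0 ((D 0).unit i)) x := by
    have := ((D (n + m : ℕ)).hasSum_ofCoord h hx).map (of E f (n + m : ℕ)) (continuous_of _)
    simpa only [of_ofCoord D hD h hx, Function.comp_def, map_smul, of_unit D hD _ 0] using this
  have hnorm := hasSum_norm_toL1 D hD h (isTempered_seminorm_unit D hD h hq) x
  simp only [mul_comm (q _), ← map_smul_eq_mul q] at hnorm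
  exact (seminorm_le_tsum_of_hasSum hq hsum hnorm.summable).trans_eq hnorm.tsum_eq

/-- The embedding into the product of copies of `ℓ¹`, one for each tempered weight. -/
def toL1Prod : IndLim E f →ₗ[ℂ] ({v // IsTempered α β v} → lp (fun _ : ι => ℂ) 1) :=
  LinearMap.pi fun v => toL1 D hD h v.2

theorem isInducing_toL1Prod : Topology.IsInducing (toL1Prod D hD h) := by
  refine IsTopologicalAddGroup.isInducing_iff_nhds_zero.2 (le_antisymm ?_ fun U hU => ?_)
  · exact Filter.tendsto_iff_comap.1 ((continuous_pi fun v =>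
      continuous_toL1 D hD h v.2).tendsto' 0 0 (map_zero (toL1Prod D hD h)))
  · obtain ⟨q, hq, hqU⟩ := exists_continuous_seminorm_lt_one_imp_mem hU
    let v : {v // IsTempered α β v} := ⟨_, isTempered_seminorm_unit D hD h hq⟩
    have hball : {y : {v // IsTempered α β v} → lp (fun _ : ι => ℂ) 1 | ‖y v‖ < 1} ∈ 𝓝 0 :=
      (continuous_apply v).norm.tendsto' 0 0 norm_zero (Iio_mem_nhds one_pos)
    exact Filter.mem_of_superset (Filter.preimage_mem_comap hball) fun x hx =>
      hqU x ((seminorm_le_norm_toL1 D hD h hq x).trans_lt hx)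

theorem range_toL1Prod : Set.range (toL1Prod D hD h) = {y | ∀ v i, y v i =
    (v.1 i : ℂ) * y ⟨Pi.single i 1, isTempered_single (fun i => (h.right_pos i).le) i⟩ i} := by
  refine Set.Subset.antisymm ?_ fun y hy => ?_
  · rintro _ ⟨x, rfl⟩ v i
    exact congrArg ((v.1 i : ℂ) * ·) (toL1_single_apply_self D hD h i x).symm
  · let z : ι → ℂ := fun i =>
      y ⟨Pi.single i 1, isTempered_single (fun i => (h.right_pos i).le) i⟩ i
    obtain ⟨C, n, hz⟩ := exists_rapidBox_of_tempered_bound (fun i => (h.left_pos i).le)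
      h.one_le_right (fun _ : Unit => z) fun v hv => ⟨‖y ⟨v, hv⟩‖, fun _ i => by
        rw [← Complex.norm_of_nonneg (hv.1 i), ← norm_mul, ← hy ⟨v, hv⟩ i]
        exact lp.norm_apply_le_norm one_ne_zero (y ⟨v, hv⟩) i⟩
    refine ⟨of E f (n + m : ℕ) ((D (n + m : ℕ)).ofCoord z),
      funext fun v => lp.ext (funext fun i => ?_)⟩
    change (v.1 i : ℂ) * coord D hD _ i = y v i
    rw [coord_of, (D _).coord_ofCoord h (hz ()), hy v i]

theorem isClosed_range_toL1Prod : IsClosed (Set.range (toL1Prod D hD h)) := by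
  have hcont : ∀ (v : {v // IsTempered α β v}) (i : ι),
      Continuous fun y : {v // IsTempered α β v} → lp (fun _ : ι => ℂ) 1 => y v i :=
    fun v i => (lp.evalCLM ℂ (fun _ : ι => ℂ) 1 i).continuous.comp (continuous_apply v)
  rw [range_toL1Prod]
  simp only [Set.ofPred_forall]
  exact isClosed_iInter fun v => isClosed_iInter fun i =>
    isClosed_eq (hcont v i) (continuous_const.mul (hcont _ i))

include h hD in
theorem completeSpace : CompleteSpace (IndLim E f) :=
  (completeSpace_iff_isComplete_range (AddMonoidHom.isUniformInducing_of_isInducing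
    (isInducing_toL1Prod D hD h))).2 (isClosed_range_toL1Prod D hD h).isComplete

omit [∀ k, IsUniformAddGroup (E k)] [∀ k, CompleteSpace (E k)] in
include h in
theorem exists_coord_image_subset_rapidBox {K : Set (IndLim E f)} (hK : IsCompact K) :
    ∃ C n, ∀ x ∈ K, coord D hD x ∈ rapidBox α β C n := by
  obtain ⟨C, n, hC⟩ := exists_rapidBox_of_tempered_bound (fun i => (h.left_pos i).le)
    h.one_le_right (fun x : K => coord D hD x) fun v hv => by
      obtain ⟨C, hC⟩ := hK.exists_bound_of_continuousOn (continuous_toL1 D hD h hv).continuousOn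
      refine ⟨C, fun x i => ?_⟩
      rw [← norm_toL1_apply D hD h hv]
      exact (lp.norm_apply_le_norm one_ne_zero _ i).trans (hC x x.2)
  exact ⟨C, n, fun x hx => hC ⟨x, hx⟩⟩

include h hD in
theorem isCompactlyRegular : IsCompactlyRegular E f := by
  have := t2Space D hD h
  intro K hK
  obtain ⟨C, n, hKC⟩ := exists_coord_image_subset_rapidBox D hD h hK
  refine ⟨(n + m : ℕ), fun x hx => ⟨_, of_ofCoord D hD h (hKC x hx)⟩, ?_⟩
  refine ((isCompact_rapidBox α β C n).image_of_continuousOn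
    ((D (n + m : ℕ)).continuousOn_ofCoord h C)).of_isClosed_subset
    (hK.isClosed.preimage (continuous_of _)) fun y hy => ?_
  have hyC := hKC _ hy
  rw [coord_of] at hyC
  exact ⟨_, hyC, (D _).coord_injective ((D _).coord_ofCoord h hyC)⟩

include h hD in
theorem isLFSpace : IsLFSpace E f where
  frechet k := (D k).isFrechetSpace
  map_self k x := (D k).coord_injective (hD _ _ _ _)
  map_map k l m hkl hlm x := (D m).coord_injective (by rw [hD, hD, hD])
  injective k l hkl x y hxy := (D k).coord_injective (by rw [← hD k l hkl, hxy, hD])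
  hausdorff := t2Space D hD h

end IndLim

end InductiveLimits

/-! ### Rapidly decreasing sequences -/

theorem one_le_pnat_cast (i : ℕ+) : (1 : ℝ) ≤ (i : ℝ) := Nat.one_le_cast.2 i.pos

theorem pnat_cast_pos (i : ℕ+) : (0 : ℝ) < (i : ℝ) := Nat.cast_pos.2 i.pos

theorem summable_pnat_inv_sq : Summable fun i : ℕ+ => ((i : ℝ) ^ 2)⁻¹ :=
  (Real.summable_nat_pow_inv.2 one_lt_two).comp_injective PNat.coe_injective

theorem isNuclearPair_fst_snd :
    IsNuclearPair (fun a : ℕ+ × ℕ+ => (a.1 : ℝ)) (fun a : ℕ+ × ℕ+ => (a.2 : ℝ)) 2 where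
  one_le_left a := one_le_pnat_cast a.1
  one_le_right a := one_le_pnat_cast a.2
  summable := by
    simp only [mul_pow, mul_inv]
    exact summable_pnat_inv_sq.mul_of_nonneg summable_pnat_inv_sq
      (fun _ => inv_nonneg.2 (sq_nonneg _)) fun _ => inv_nonneg.2 (sq_nonneg _)

namespace RapidSeq

instance : IsTopologicalAddGroup RapidSeq := withSeminorms_rapid.topologicalAddGroup

/-- The coordinates of a rapidly decreasing sequence. -/
def coord : RapidSeq →ₗ[ℂ] (ℕ+ → ℂ) := rapidSubmodule.subtype

/-- The map `a ↦ (i ^ r * a i)_i` to the space of bounded sequences. -/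
def toBounded (r : ℕ) : RapidSeq →L[ℂ] lp (fun _ : ℕ+ => ℂ) ∞ where
  toLinearMap := (WeightedLp.toLp ∞ (-(r : ℤ))).comp (toWeighted r)
  cont := withSeminorms_rapid.continuous_normedSpace_rng _ _ ⟨{r}, 1, fun a => by
    rw [one_smul, Finset.sup_singleton]
    exact le_rfl⟩

theorem toBounded_apply (r : ℕ) (a : RapidSeq) (i : ℕ+) :
    toBounded r a i = (i : ℂ) ^ r * coord a i := by
  change weight (-(r : ℤ)) a.1 i = _
  simp only [weight, neg_neg, zpow_natCast]
  rfl

theorem norm_toBounded (r : ℕ) (a : RapidSeq) : ‖toBounded r a‖ = rapidSeminorms r a := rfl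

theorem norm_toBounded_apply (r : ℕ) (a : RapidSeq) (i : ℕ+) :
    ‖toBounded r a i‖ = (i : ℝ) ^ r * ‖coord a i‖ := by
  rw [toBounded_apply, norm_mul, norm_pow, Complex.norm_natCast]

theorem pow_mul_norm_coord_le (r : ℕ) (a : RapidSeq) (i : ℕ+) :
    (i : ℝ) ^ r * ‖coord a i‖ ≤ rapidSeminorms r a := by
  rw [← norm_toBounded_apply, ← norm_toBounded]
  exact lp.norm_apply_le_norm ENNReal.top_ne_zero (toBounded r a) i

theorem rapidSeminorms_le {r : ℕ} {a : RapidSeq} {C : ℝ} (hC : 0 ≤ C)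
    (h : ∀ i : ℕ+, (i : ℝ) ^ r * ‖coord a i‖ ≤ C) : rapidSeminorms r a ≤ C := by
  rw [← norm_toBounded]
  exact lp.norm_le_of_forall_le hC fun i => (norm_toBounded_apply r a i).trans_le (h i)

theorem pow_mul_norm_single_le (r : ℕ) (i j : ℕ+) :
    (j : ℝ) ^ r * ‖(Pi.single i 1 : ℕ+ → ℂ) j‖ ≤ (i : ℝ) ^ r := by
  obtain rfl | hj := eq_or_ne j i
  · rw [Pi.single_eq_same, norm_one, mul_one]
  · rw [Pi.single_eq_of_ne hj, norm_zero, mul_zero]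
    exact pow_nonneg (pnat_cast_pos i).le r

/-- The unit vectors of `s`. -/
def unit (i : ℕ+) : RapidSeq :=
  ⟨Pi.single i 1, (Submodule.mem_iInf _).2 fun r => memℓp_infty ⟨(i : ℝ) ^ r, by
    rintro _ ⟨j, rfl⟩
    simpa [weight] using pow_mul_norm_single_le r i j⟩⟩

theorem coord_unit (i : ℕ+) : coord (unit i) = Pi.single i 1 := rfl

theorem rapidSeminorms_unit_le (r : ℕ) (i : ℕ+) : rapidSeminorms r (unit i) ≤ (i : ℝ) ^ r :=
  rapidSeminorms_le (pow_nonneg (pnat_cast_pos i).le r) (pow_mul_norm_single_le r i)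

theorem coord_sum_smul_unit (a : RapidSeq) (s : Finset ℕ+) (i : ℕ+) :
    coord (∑ j ∈ s, coord a j • unit j) i = if i ∈ s then coord a i else 0 := by
  simp only [map_sum, map_smul, coord_unit, Finset.sum_apply, Pi.smul_apply, Pi.single_apply,
    smul_eq_mul, mul_ite, mul_one, mul_zero, Finset.sum_ite_eq]

theorem rapidSeminorms_sub_sum_le (r : ℕ) (a : RapidSeq) {N : ℕ} (hN : 0 < N) {s : Finset ℕ+}
    (hs : ∀ i : ℕ+, (i : ℕ) < N → i ∈ s) :
    rapidSeminorms r (a - ∑ i ∈ s, coord a i • unit i) ≤ rapidSeminorms (r + 1) a / N := by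
  have hN' : (0 : ℝ) < N := Nat.cast_pos.2 hN
  have hnonneg : 0 ≤ rapidSeminorms (r + 1) a / N := div_nonneg (apply_nonneg _ _) hN'.le
  refine rapidSeminorms_le hnonneg fun i => ?_
  rw [map_sub, Pi.sub_apply, coord_sum_smul_unit]
  split_ifs with hi
  · rwa [sub_self, norm_zero, mul_zero]
  · have hNi : (N : ℝ) ≤ i := Nat.cast_le.2 (not_lt.1 fun hlt => hi (hs i hlt))
    rw [sub_zero, le_div_iff₀ hN']
    calc (i : ℝ) ^ r * ‖coord a i‖ * N ≤ (i : ℝ) ^ r * ‖coord a i‖ * i := by gcongr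
      _ = (i : ℝ) ^ (r + 1) * ‖coord a i‖ := by ring
      _ ≤ rapidSeminorms (r + 1) a := pow_mul_norm_coord_le (r + 1) a i

theorem hasSum_unit (a : RapidSeq) : HasSum (fun i => coord a i • unit i) a := by
  refine (withSeminorms_rapid.tendsto_nhds _ _).2 fun r ε hε => ?_
  obtain ⟨N, hN⟩ := exists_nat_gt (rapidSeminorms (r + 1) a / ε)
  have hN0 : (0 : ℝ) < N := (div_nonneg (apply_nonneg _ _) hε.le).trans_lt hN
  have hfin : {i : ℕ+ | (i : ℕ) < N}.Finite :=
    (Set.finite_Iio N).preimage PNat.coe_injective.injOn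
  filter_upwards [Filter.eventually_ge_atTop hfin.toFinset] with s hs
  rw [map_sub_rev]
  refine (rapidSeminorms_sub_sum_le r a (Nat.cast_pos.1 hN0) fun i hi =>
    hs (hfin.mem_toFinset.2 hi)).trans_lt ?_
  rwa [div_lt_iff₀ hN0, ← div_lt_iff₀' hε]

end RapidSeq

/-! ### Tensor products of `s` with Banach spaces -/

namespace ProjTensor

section Lift

variable {E F W : Type*} [AddCommGroup E] [Module ℂ E] [AddCommGroup F] [Module ℂ F]

@[elab_as_elim]
theorem induction_on {P : ProjTensor E F → Prop} (z : ProjTensor E F) (zero : P 0)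
    (mk : ∀ a b, P (ProjTensor.mk E F a b)) (add : ∀ y z, P y → P z → P (y + z)) : P z :=
  TensorProduct.induction_on z zero mk add

variable [TopologicalSpace E] [TopologicalSpace F] [AddCommGroup W] [Module ℂ W]
  [TopologicalSpace W] [IsTopologicalAddGroup W] [ContinuousSMul ℂ W] [Module ℝ W]
  [IsScalarTower ℝ ℂ W] [LocallyConvexSpace ℝ W]

/-- The continuous linear map on the projective tensor product that corresponds to a jointly
continuous bilinear map into a locally convex space. -/
def lift (B : E →ₗ[ℂ] F →ₗ[ℂ] W) (hB : Continuous fun x : E × F => B x.1 x.2) :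
    ProjTensor E F →L[ℂ] W where
  toLinearMap := TensorProduct.lift B
  cont := continuous_of_finestLocallyConvex (TensorProduct.lift B) (continuous_induced_rng.2
    (hB.congr fun x => (TensorProduct.lift.tmul x.1 x.2).symm))

theorem lift_mk (B : E →ₗ[ℂ] F →ₗ[ℂ] W) (hB : Continuous fun x : E × F => B x.1 x.2) (a : E)
    (b : F) : lift B hB (mk E F a b) = B a b :=
  TensorProduct.lift.tmul a b

end Lift

end ProjTensor

section RapidTensor

variable (X : Type*) [NormedAddCommGroup X] [NormedSpace ℂ X]

/-- The map `(y, a) ↦ (a i • y)_i` for bounded sequences `a`. -/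
def boundedSMul (ι : Type*) : X →L[ℂ] lp (fun _ : ι => ℂ) ∞ →L[ℂ] lp (fun _ : ι => X) ∞ :=
  LinearMap.mkContinuous
    { toFun := fun y => lp.mapCLM ∞ (fun _ => ContinuousLinearMap.toSpanSingleton ℂ y)
        (norm_nonneg y) fun _ => (ContinuousLinearMap.norm_toSpanSingleton y).le
      map_add' := fun y z => by ext a i; simp
      map_smul' := fun c y => by ext a i; simp [smul_comm (a i) c y] } 1 fun y => by
    rw [one_mul]
    exact lp.norm_mapCLM_le ∞ (fun _ : ι => ContinuousLinearMap.toSpanSingleton ℂ y)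
      (norm_nonneg y) fun _ => (ContinuousLinearMap.norm_toSpanSingleton y).le

namespace ProjTensor

/-- The continuous linear map that takes `a ⊗ y` to `(i ^ r * a i • y)_i`. -/
def toBounded (r : ℕ) : ProjTensor RapidSeq X →L[ℂ] lp (fun _ : ℕ+ => X) ∞ :=
  lift (((boundedSMul X ℕ+).flip.comp (RapidSeq.toBounded r)).toLinearMap₁₂)
    ((boundedSMul X ℕ+).flip.continuous₂.comp
      (((RapidSeq.toBounded r).continuous.comp continuous_fst).prodMk continuous_snd))

theorem toBounded_mk (r : ℕ) (a : RapidSeq) (y : X) (i : ℕ+) :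
    toBounded X r (mk RapidSeq X a y) i = ((i : ℂ) ^ r * RapidSeq.coord a i) • y := by
  rw [← RapidSeq.toBounded_apply]
  have hmk : toBounded X r (mk RapidSeq X a y) = boundedSMul X ℕ+ y (RapidSeq.toBounded r a) :=
    lift_mk _ _ a y
  rw [hmk]
  rfl

theorem toBounded_apply (r : ℕ) (z : ProjTensor RapidSeq X) (i : ℕ+) :
    toBounded X r z i = (i : ℂ) ^ r • toBounded X 0 z i := by
  induction z using ProjTensor.induction_on with
  | zero => rw [map_zero, map_zero, lp.coeFn_zero, Pi.zero_apply, smul_zero]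
  | mk a y => rw [toBounded_mk, toBounded_mk, smul_smul, pow_zero, one_mul]
  | add y z hy hz =>
    rw [map_add, map_add, lp.coeFn_add, lp.coeFn_add, Pi.add_apply, Pi.add_apply, hy, hz, smul_add]

theorem hasSum_mk_unit (z : ProjTensor RapidSeq X) :
    HasSum (fun i => mk RapidSeq X (RapidSeq.unit i) (toBounded X 0 z i)) z := by
  induction z using ProjTensor.induction_on with
  | zero => simp only [map_zero, lp.coeFn_zero, Pi.zero_apply, hasSum_zero]
  | mk a y =>
    have hcont : Continuous fun b => mk RapidSeq X b y :=
      (continuous_mk RapidSeq X).comp (continuous_id.prodMk continuous_const)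
    refine ((RapidSeq.hasSum_unit a).map ((mk RapidSeq X).flip y) hcont).congr_fun fun i => ?_
    rw [toBounded_mk, pow_zero, one_mul, Function.comp_apply, LinearMap.flip_apply, map_smul,
      map_smul, LinearMap.smul_apply]
  | add y z hy hz =>
    refine (hy.add hz).congr_fun fun i => ?_
    rw [map_add, lp.coeFn_add, Pi.add_apply, map_add]

variable {X}

theorem exists_seminorm_mk_unit_le {p : Seminorm ℂ (ProjTensor RapidSeq X)} (hp : Continuous p) :
    ∃ (r : ℕ) (C : ℝ), 0 ≤ C ∧
      ∀ i y, p (mk RapidSeq X (RapidSeq.unit i) y) ≤ C * (i : ℝ) ^ r * ‖y‖ := by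
  obtain ⟨s, C, hC, h⟩ := exists_seminorm_bilinear_le withSeminorms_rapid (mk RapidSeq X)
    (continuous_mk RapidSeq X) hp
  have hunit : ∀ i, s.sup rapidSeminorms (RapidSeq.unit i) ≤ (i : ℝ) ^ s.sup id := fun i =>
    Seminorm.finset_sup_apply_le (pow_nonneg (pnat_cast_pos i).le _) fun r hr =>
      (RapidSeq.rapidSeminorms_unit_le r i).trans
        (pow_le_pow_right₀ (one_le_pnat_cast i) (Finset.le_sup (f := id) hr))
  refine ⟨s.sup id, C, hC, fun i y => (h _ _).trans ?_⟩
  gcongr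
  exact hunit i

theorem exists_seminorm_le_norm_toBounded {p : Seminorm ℂ (ProjTensor RapidSeq X)}
    (hp : Continuous p) : ∃ (r : ℕ) (C : ℝ), 0 ≤ C ∧ ∀ z, p z ≤ C * ‖toBounded X r z‖ := by
  obtain ⟨r, C, hC, h⟩ := exists_seminorm_mk_unit_le hp
  refine ⟨r + 2, C * ∑' i : ℕ+, ((i : ℝ) ^ 2)⁻¹,
    mul_nonneg hC (tsum_nonneg fun _ => inv_nonneg.2 (sq_nonneg _)), fun z => ?_⟩
  have hterm : ∀ i, p (mk RapidSeq X (RapidSeq.unit i) (toBounded X 0 z i)) ≤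
      C * ‖toBounded X (r + 2) z‖ * ((i : ℝ) ^ 2)⁻¹ := fun i => by
    have hi := pnat_cast_pos i
    have hnorm := lp.norm_apply_le_norm ENNReal.top_ne_zero (toBounded X (r + 2) z) i
    rw [toBounded_apply, norm_smul, norm_pow, Complex.norm_natCast] at hnorm
    refine (h i _).trans ?_
    rw [← div_eq_mul_inv, le_div_iff₀ (pow_pos hi 2)]
    calc C * (i : ℝ) ^ r * ‖toBounded X 0 z i‖ * (i : ℝ) ^ 2
        = C * ((i : ℝ) ^ (r + 2) * ‖toBounded X 0 z i‖) := by ring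
      _ ≤ C * ‖toBounded X (r + 2) z‖ := by gcongr
  have hsum := summable_pnat_inv_sq.mul_left (C * ‖toBounded X (r + 2) z‖)
  have hsum' := hsum.of_nonneg_of_le (fun _ => apply_nonneg p _) hterm
  calc p z ≤ ∑' i, p (mk RapidSeq X (RapidSeq.unit i) (toBounded X 0 z i)) :=
        seminorm_le_tsum_of_hasSum hp (hasSum_mk_unit X z) hsum'
    _ ≤ ∑' i : ℕ+, C * ‖toBounded X (r + 2) z‖ * ((i : ℝ) ^ 2)⁻¹ := hsum'.tsum_le_tsum hterm hsum
    _ = C * (∑' i : ℕ+, ((i : ℝ) ^ 2)⁻¹) * ‖toBounded X (r + 2) z‖ := by rw [tsum_mul_left]; ring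

theorem exists_norm_toBounded_lt_imp_mem {U : Set (ProjTensor RapidSeq X)} (hU : U ∈ 𝓝 0) :
    ∃ r : ℕ, ∃ ε > 0, ∀ z, ‖toBounded X r z‖ < ε → z ∈ U := by
  obtain ⟨p, hp, hpU⟩ := exists_continuous_seminorm_lt_one_imp_mem hU
  obtain ⟨r, C, hC, hle⟩ := exists_seminorm_le_norm_toBounded hp
  have hC1 : 0 < C + 1 := by positivity
  refine ⟨r, (C + 1)⁻¹, inv_pos.2 hC1, fun z hz => hpU z ?_⟩
  calc p z ≤ C * ‖toBounded X r z‖ := hle z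
    _ ≤ (C + 1) * ‖toBounded X r z‖ := by gcongr; exact (lt_add_one C).le
    _ < (C + 1) * (C + 1)⁻¹ := by gcongr
    _ = 1 := mul_inv_cancel₀ hC1.ne'

end ProjTensor

namespace CompletedTensor

variable [CompleteSpace X]

/-- The extension of `a ⊗ y ↦ (i ^ r * a i • y)_i` to the completed tensor product. -/
def toBounded (r : ℕ) : CompletedTensor RapidSeq X →L[ℂ] lp (fun _ : ℕ+ => X) ∞ :=
  (ProjTensor.toBounded X r).fromCompletion

theorem toBounded_coe (r : ℕ) (z : ProjTensor RapidSeq X) :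
    toBounded X r (z : CompletedTensor RapidSeq X) = ProjTensor.toBounded X r z :=
  (ProjTensor.toBounded X r).fromCompletion_apply_coe z

theorem continuous_toBounded_apply (r : ℕ) (i : ℕ+) : Continuous fun x => toBounded X r x i :=
  (lp.evalCLM ℂ (fun _ : ℕ+ => X) ∞ i).continuous.comp (toBounded X r).continuous

theorem toBounded_apply (r : ℕ) (x : CompletedTensor RapidSeq X) (i : ℕ+) :
    toBounded X r x i = (i : ℂ) ^ r • toBounded X 0 x i := by
  refine UniformSpace.Completion.induction_on x (isClosed_eq (continuous_toBounded_apply X r i)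
    ((continuous_toBounded_apply X 0 i).const_smul _)) fun z => ?_
  rw [toBounded_coe, toBounded_coe, ProjTensor.toBounded_apply]

theorem pow_mul_norm_toBounded_zero_le (r : ℕ) (x : CompletedTensor RapidSeq X) (i : ℕ+) :
    (i : ℝ) ^ r * ‖toBounded X 0 x i‖ ≤ ‖toBounded X r x‖ := by
  have hnorm := lp.norm_apply_le_norm ENNReal.top_ne_zero (toBounded X r x) i
  rwa [toBounded_apply, norm_smul, norm_pow, Complex.norm_natCast] at hnorm

/-- The seminorms `x ↦ sup_i i ^ r * ‖x i‖` of `s ⊗ X`. -/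
def rapidSeminorms : SeminormFamily ℂ (CompletedTensor RapidSeq X) ℕ := fun r =>
  (normSeminorm ℂ (lp (fun _ : ℕ+ => X) ∞)).comp (toBounded X r).toLinearMap

theorem rapidSeminorms_mk_le (r : ℕ) (a : RapidSeq) (y : X) :
    rapidSeminorms X r (ProjTensor.mk RapidSeq X a y : ProjTensor RapidSeq X) ≤
      _root_.rapidSeminorms r a * ‖y‖ := by
  change ‖toBounded X r _‖ ≤ _
  rw [toBounded_coe]
  refine lp.norm_le_of_forall_le (mul_nonneg (apply_nonneg _ _) (norm_nonneg y)) fun i => ?_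
  rw [ProjTensor.toBounded_mk, norm_smul, norm_mul, norm_pow, Complex.norm_natCast]
  gcongr
  exact RapidSeq.pow_mul_norm_coord_le r a i

theorem withSeminorms_rapidSeminorms : WithSeminorms (rapidSeminorms X) :=
  withSeminorms_fromCompletion _ fun _ => ProjTensor.exists_norm_toBounded_lt_imp_mem

theorem toBounded_zero_injective : Function.Injective (toBounded X 0) := by
  rw [injective_iff_map_eq_zero]
  intro x hx
  by_contra hne
  obtain ⟨r, hr⟩ := (withSeminorms_rapidSeminorms X).separating_of_T1 x hne
  have hzero : toBounded X r x = 0 := lp.ext (funext fun i =>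
    (toBounded_apply X r x i).trans (by rw [hx, lp.coeFn_zero, Pi.zero_apply, smul_zero]))
  exact hr (norm_eq_zero.2 hzero)

end CompletedTensor

end RapidTensor

/-! ### Tensor products of `s` with Banach spaces of sequences -/

/-- A realization of the normed space `X` as a space of sequences, with a norm that behaves like a
norm with weight `j ^ (-k)` on the coordinates and on the unit vectors. -/
structure SequenceCoordinates (k : ℤ) (X : Type*) [NormedAddCommGroup X] [NormedSpace ℂ X] where
  coord : X →ₗ[ℂ] (ℕ+ → ℂ)
  unit : ℕ+ → X
  coord_injective : Function.Injective coord
  coord_unit : ∀ j, coord (unit j) = Pi.single j 1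
  norm_coord_le : ∀ x (j : ℕ+), ‖coord x j‖ ≤ (j : ℝ) ^ k * ‖x‖
  norm_unit_le : ∀ j : ℕ+, ‖unit j‖ ≤ (j : ℝ) ^ (-k)

namespace SequenceCoordinates

variable {k : ℤ} {X : Type*} [NormedAddCommGroup X] [NormedSpace ℂ X] [CompleteSpace X]
  (S : SequenceCoordinates k X)

/-- The double sequence of an element of the completed tensor product of `s` and a Banach space
of sequences. -/
def tensorCoord : CompletedTensor RapidSeq X →ₗ[ℂ] (ℕ+ × ℕ+ → ℂ) where
  toFun x a := S.coord (CompletedTensor.toBounded X 0 x a.1) a.2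
  map_add' x y := by
    funext a
    rw [map_add, lp.coeFn_add, Pi.add_apply, map_add]
    rfl
  map_smul' c x := by
    funext a
    rw [map_smul, lp.coeFn_smul, Pi.smul_apply, map_smul]
    rfl

theorem tensorCoord_apply (x : CompletedTensor RapidSeq X) (a : ℕ+ × ℕ+) :
    S.tensorCoord x a = S.coord (CompletedTensor.toBounded X 0 x a.1) a.2 :=
  rfl

theorem tensorCoord_mk (b : RapidSeq) (y : X) (a : ℕ+ × ℕ+) :
    S.tensorCoord (ProjTensor.mk RapidSeq X b y : ProjTensor RapidSeq X) a =
      RapidSeq.coord b a.1 * S.coord y a.2 := by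
  rw [tensorCoord_apply, CompletedTensor.toBounded_coe, ProjTensor.toBounded_mk, pow_zero, one_mul,
    map_smul, Pi.smul_apply, smul_eq_mul]

theorem tensorCoord_injective : Function.Injective S.tensorCoord := fun _ _ h =>
  CompletedTensor.toBounded_zero_injective X (lp.ext (funext fun i =>
    S.coord_injective (funext fun j => congrFun h (i, j))))

theorem pow_mul_norm_tensorCoord_le (r : ℕ) (x : CompletedTensor RapidSeq X) (a : ℕ+ × ℕ+) :
    (a.1 : ℝ) ^ r * ‖S.tensorCoord x a‖ ≤
      (a.2 : ℝ) ^ k * CompletedTensor.rapidSeminorms X r x := by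
  have : 0 < (a.2 : ℝ) ^ k := zpow_pos (pnat_cast_pos a.2) k
  calc (a.1 : ℝ) ^ r * ‖S.tensorCoord x a‖
      ≤ (a.1 : ℝ) ^ r * ((a.2 : ℝ) ^ k * ‖CompletedTensor.toBounded X 0 x a.1‖) := by
        gcongr
        exact S.norm_coord_le _ _
    _ = (a.2 : ℝ) ^ k * ((a.1 : ℝ) ^ r * ‖CompletedTensor.toBounded X 0 x a.1‖) := by ring
    _ ≤ (a.2 : ℝ) ^ k * ‖CompletedTensor.toBounded X r x‖ := by
        gcongr
        exact CompletedTensor.pow_mul_norm_toBounded_zero_le X r x a.1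

/-- The completed tensor product of `s` and a Banach space of sequences, as a space of double
sequences with the weights `i ^ r * j ^ (-k)`. -/
def tensor : PowerCoordinates (fun a : ℕ+ × ℕ+ => (a.1 : ℝ)) (fun a => (a.2 : ℝ)) k
    (CompletedTensor RapidSeq X) where
  seminorm := CompletedTensor.rapidSeminorms X
  withSeminorms := CompletedTensor.withSeminorms_rapidSeminorms X
  coord := S.tensorCoord
  unit a := (ProjTensor.mk RapidSeq X (RapidSeq.unit a.1) (S.unit a.2) : ProjTensor RapidSeq X)
  coord_injective := S.tensorCoord_injective
  coord_unit a := by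
    funext b
    rw [tensorCoord_mk, RapidSeq.coord_unit, S.coord_unit]
    simp only [Pi.single_apply, Prod.ext_iff, ite_and, mul_ite, mul_one, mul_zero]
    split_ifs <;> rfl
  coord_le := S.pow_mul_norm_tensorCoord_le
  seminorm_unit_le r a := (CompletedTensor.rapidSeminorms_mk_le X r _ _).trans
    (mul_le_mul (RapidSeq.rapidSeminorms_unit_le r a.1) (S.norm_unit_le a.2) (norm_nonneg _)
      (pow_nonneg (pnat_cast_pos a.1).le r))

theorem tensorCoord_lTensor {l : ℤ} {Y : Type*} [NormedAddCommGroup Y] [NormedSpace ℂ Y]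
    [CompleteSpace Y] (T : SequenceCoordinates l Y) {g : X →L[ℂ] Y}
    (hg : ∀ x, T.coord (g x) = S.coord x) (x : CompletedTensor RapidSeq X) :
    T.tensorCoord (CompletedTensor.lTensor RapidSeq g x) = S.tensorCoord x := by
  refine UniformSpace.Completion.induction_on x (isClosed_eq
    (T.tensor.continuous_coord.comp (CompletedTensor.lTensor RapidSeq g).continuous)
    S.tensor.continuous_coord) fun z => ?_
  have hz : CompletedTensor.lTensor RapidSeq g (z : CompletedTensor RapidSeq X) =
      (ProjTensor.lTensor RapidSeq g z : ProjTensor RapidSeq Y) :=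
    ProjTensor.completion_map_coe RapidSeq g z
  rw [hz]
  clear hz
  induction z using ProjTensor.induction_on with
  | zero => simp only [map_zero, UniformSpace.Completion.coe_zero]
  | mk b y =>
    have hmk : ProjTensor.lTensor RapidSeq g (ProjTensor.mk RapidSeq X b y) =
        ProjTensor.mk RapidSeq Y b (g y) := LinearMap.lTensor_tmul _ _ _ _
    funext a
    rw [hmk, tensorCoord_mk, tensorCoord_mk, hg]
  | add y z hy hz => rw [map_add, UniformSpace.Completion.coe_add, UniformSpace.Completion.coe_add,
      map_add, map_add, hy, hz]

end SequenceCoordinates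

theorem weight_apply (k : ℤ) (x : ℕ+ → ℂ) (j : ℕ+) : weight k x j = (j : ℂ) ^ (-k) * x j :=
  rfl

theorem weight_weight_neg (k : ℤ) (x : ℕ+ → ℂ) : weight k (weight (-k) x) = x := by
  funext j
  have hj : (j : ℂ) ≠ 0 := Nat.cast_ne_zero.2 j.ne_zero
  rw [weight_apply, weight_apply, ← mul_assoc, ← zpow_add₀ hj, neg_neg, neg_add_cancel, zpow_zero,
    one_mul]

theorem weight_single (k : ℤ) (i : ℕ+) :
    weight k (Pi.single i 1) = Pi.single i ((i : ℂ) ^ (-k)) := by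
  funext j
  rw [weight_apply, Pi.single_apply, Pi.single_apply]
  split_ifs with h
  · rw [h, mul_one]
  · rw [mul_zero]

theorem norm_eq_zpow_mul_norm_weight (k : ℤ) (x : ℕ+ → ℂ) (j : ℕ+) :
    ‖x j‖ = (j : ℝ) ^ k * ‖weight k x j‖ := by
  rw [weight_apply, norm_mul, norm_zpow, Complex.norm_natCast, ← mul_assoc,
    ← zpow_add₀ (pnat_cast_pos j).ne', add_neg_cancel, zpow_zero, one_mul]

namespace WeightedLp

variable (p : ℝ≥0∞) (k : ℤ)

theorem toLp_surjective : Function.Surjective (toLp p k) := fun y =>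
  ⟨⟨weight (-k) y, by
    change Memℓp (weight k (weight (-k) y)) p
    rw [weight_weight_neg]
    exact lp.memℓp y⟩, lp.ext (weight_weight_neg k y)⟩

/-- The inclusion of `(ℓ^p)_{-k}` in the space of all sequences. -/
def coord : WeightedLp p k →ₗ[ℂ] (ℕ+ → ℂ) := (weightedLpSubmodule p k).subtype

/-- The unit vectors of `(ℓ^p)_{-k}`. -/
def unit (i : ℕ+) : WeightedLp p k :=
  ⟨Pi.single i 1, by
    change Memℓp (weight k (Pi.single i 1)) p
    rw [weight_single, ← lp.coeFn_single (E := fun _ => ℂ) p]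
    exact lp.memℓp _⟩

theorem toLp_unit (i : ℕ+) : toLp p k (unit p k i) = lp.single p i ((i : ℂ) ^ (-k)) :=
  lp.ext ((weight_single k i).trans (lp.coeFn_single (E := fun _ => ℂ) p i _).symm)

variable [Fact (1 ≤ p)]

theorem norm_toLp (x : WeightedLp p k) : ‖toLp p k x‖ = ‖x‖ :=
  rfl

instance : CompleteSpace (WeightedLp p k) :=
  ((AddMonoidHomClass.isometry_of_norm (toLp p k)
    (norm_toLp p k)).isUniformInducing.completeSpace_congr (toLp_surjective p k)).2 inferInstance

theorem norm_weight_coord_le (x : WeightedLp p k) (j : ℕ+) : ‖weight k (coord p k x) j‖ ≤ ‖x‖ :=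
  lp.norm_apply_le_norm (zero_lt_one.trans_le (Fact.out : 1 ≤ p)).ne' (toLp p k x) j

theorem norm_coord_le (x : WeightedLp p k) (j : ℕ+) : ‖coord p k x j‖ ≤ (j : ℝ) ^ k * ‖x‖ := by
  rw [norm_eq_zpow_mul_norm_weight k]
  exact mul_le_mul_of_nonneg_left (norm_weight_coord_le p k x j) (zpow_pos (pnat_cast_pos j) k).le

theorem norm_unit (j : ℕ+) : ‖unit p k j‖ = (j : ℝ) ^ (-k) := by
  rw [← norm_toLp, toLp_unit, lp.norm_single (zero_lt_one.trans_le (Fact.out : 1 ≤ p)), norm_zpow,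
    Complex.norm_natCast]

/-- `(ℓ^p)_{-k}` as a Banach space of sequences. -/
def sequenceCoordinates : SequenceCoordinates k (WeightedLp p k) where
  coord := coord p k
  unit := unit p k
  coord_injective := Subtype.val_injective
  coord_unit _ := rfl
  norm_coord_le := norm_coord_le p k
  norm_unit_le j := (norm_unit p k j).le

variable {k} in
theorem coord_incl {l : ℤ} (h : k ≤ l) (x : WeightedLp p k) :
    coord p l (incl p h x) = coord p k x :=
  Submodule.coe_inclusion (p := weightedLpSubmodule p k) (p' := weightedLpSubmodule p l)
    (fun _ => mem_weightedLp_of_le p h) x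

end WeightedLp

namespace WeightedC0

variable (k : ℤ)

theorem isClosed : IsClosed (WeightedC0 k : Set (WeightedLp ∞ k)) := by
  refine isClosed_of_closure_subset fun x hx => ?_
  refine Metric.tendsto_nhds.2 fun ε hε => ?_
  obtain ⟨y, hy, hxy⟩ := Metric.mem_closure_iff.1 hx (ε / 2) (half_pos hε)
  have hy' : Filter.Tendsto (weight k y.1) Filter.cofinite (𝓝 0) := hy
  filter_upwards [Metric.tendsto_nhds.1 hy' (ε / 2) (half_pos hε)] with j hj
  have hdist := WeightedLp.norm_weight_coord_le ∞ k (x - y) j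
  rw [map_sub, map_sub, Pi.sub_apply] at hdist
  rw [dist_eq_norm] at hxy
  rw [dist_zero_right] at hj ⊢
  calc ‖weight k x.1 j‖ ≤ ‖weight k x.1 j - weight k y.1 j‖ + ‖weight k y.1 j‖ :=
        norm_le_norm_sub_add _ _
    _ < ε / 2 + ε / 2 := add_lt_add (hdist.trans_lt hxy) hj
    _ = ε := add_halves ε

instance : CompleteSpace (WeightedC0 k) := (isClosed k).completeSpace_coe

/-- The unit vectors of `(c_0)_{-k}`. -/
def unit (i : ℕ+) : WeightedC0 k :=
  ⟨WeightedLp.unit ∞ k i, by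
    change Filter.Tendsto (weight k (Pi.single i 1)) Filter.cofinite (𝓝 0)
    refine tendsto_nhds_of_eventually_eq ?_
    filter_upwards [(Set.finite_singleton i).compl_mem_cofinite] with j hj
    rw [weight_single, Pi.single_eq_of_ne hj]⟩

/-- `(c_0)_{-k}` as a Banach space of sequences. -/
def sequenceCoordinates : SequenceCoordinates k (WeightedC0 k) where
  coord := (WeightedLp.coord ∞ k).comp (WeightedC0 k).subtype
  unit := unit k
  coord_injective := Subtype.val_injective.comp Subtype.val_injective
  coord_unit _ := rfl
  norm_coord_le x := WeightedLp.norm_coord_le ∞ k x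
  norm_unit_le j := (WeightedLp.norm_unit ∞ k j).le

end WeightedC0

theorem proposition2p2_general {X : ℤ → Type*} [∀ k, NormedAddCommGroup (X k)]
    [∀ k, NormedSpace ℂ (X k)] [∀ k, CompleteSpace (X k)] (S : ∀ k, SequenceCoordinates k (X k))
    (g : ∀ k l : ℤ, k ≤ l → X k →L[ℂ] X l)
    (hg : ∀ k l hkl x, (S l).coord (g k l hkl x) = (S k).coord x) :
    IsLFSpace (fun k => CompletedTensor RapidSeq (X k))
        (fun k l hkl => CompletedTensor.lTensor RapidSeq (g k l hkl)) ∧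
      IsCompactlyRegular (fun k => CompletedTensor RapidSeq (X k))
        (fun k l hkl => CompletedTensor.lTensor RapidSeq (g k l hkl)) ∧
      CompleteSpace (IndLim (fun k => CompletedTensor RapidSeq (X k))
        (fun k l hkl => CompletedTensor.lTensor RapidSeq (g k l hkl))) := by
  have hcoord := fun k l hkl => (S k).tensorCoord_lTensor (S l) (hg k l hkl)
  have hnuclear := isNuclearPair_fst_snd
  exact ⟨IndLim.isLFSpace (fun k => (S k).tensor) hcoord hnuclear,
    IndLim.isCompactlyRegular (fun k => (S k).tensor) hcoord hnuclear,
    IndLim.completeSpace (fun k => (S k).tensor) hcoord hnuclear⟩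

end

theorem proposition2p2 :
    (∀ (p : ℝ≥0∞) [Fact (1 ≤ p)],
      IsLFSpace (LpStep p) (lpLink p) ∧
      IsCompactlyRegular (LpStep p) (lpLink p) ∧
      CompleteSpace (IndLim (LpStep p) (lpLink p))) ∧
    (IsLFSpace C0Step c0Link ∧
      IsCompactlyRegular C0Step c0Link ∧
      CompleteSpace (IndLim C0Step c0Link)) :=
  ⟨fun p _ => proposition2p2_general (fun k => WeightedLp.sequenceCoordinates p k)
      (fun _ _ h => WeightedLp.incl p h) fun _ _ h => WeightedLp.coord_incl p h,
    proposition2p2_general WeightedC0.sequenceCoordinates (fun _ _ h => WeightedC0.incl h)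
      fun _ _ h x => WeightedLp.coord_incl ∞ h x.1⟩
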